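/- **Problem.** Let $1\le N\le M\le 2^m$. A string $x=(x_1,\dots,x_N)\in[M]^N$ is accessible only through the index oracle $O_x|i\rangle|b\rangle=|i\rangle|b\oplus x_i\rangle$, where $i\in[N]$, $b\in\{0,1\}^m$, the values $x_i$ are stored as distinct $m$-bit strings and $\oplus$ is bitwise XOR. It is promised that either the $x_i$ are pairwise distinct or there is exactly one pair $\{i,j\}$, $i\ne j$, with $x_i=x_j$. The task is to output the indices of the colliding pair, or "all distinct". A quantum query algorithm starts in a fixed basis state of (index register) $\otimes$ (answer register) $\otimes$ (finite workspace), applies input-independent unitaries alternating with $O_x$, measures in the computational basis and reads its answer off the outcome. It is *exact* if it outputs a correct answer with probability $1$ on every $x$ that satisfies the promise. **Theorem.** There is a constant $C>0$ such that for all $1\le N\le M\le 2^m$ there is an exact quantum query algorithm for this problem that makes at most $C\,N^{2/3}$ queries. Moreover, for $N\ge5$ and $r=\lfloor N^{2/3}\rfloor$, it can be taken to be the following quantum walk on the quasi-Johnson graph, for suitable real phases $\theta_1,\theta_2,\alpha_1,\alpha_2$ and iteration numbers $t_1,t$ (depending on $N$). The vertices are the pairs $(S,y)$ with $S\subset[N]$,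 $|S|=r$, $y\in[N]\setminus S$; the basis states are $|S,y\rangle|x_1',\dots,x_{r+1}'\rangle$ with $m$-bit slots $x_j'$, the first $r$ slots belonging to the elements of $S$ in ascending order and the last one to $y$. Let - $U_A(\theta)=I-(1-e^{i\theta})\sum_{|S|=r}|A_S\rangle\langle A_S|$, with $|A_S\rangle=\frac1{\sqrt{N-r}}\sum_{y\notin S}|S,y\rangle$, act on the first register; - $U_B(\theta)=I-(1-e^{i\theta})\sum_{K,g}|B_K^g\rangle\langle B_K^g|$, summed over the sets $K\subset[N]$ with $|K|=r+1$ and the maps $g:K\to[M]$, where $|B_K^g\rangle$ is $\frac1{\sqrt{r+1}}$ times the sum over $y\in K$ of the basis states $|K\setminus\{y\},y\rangle$ in which the slot of each $k\in K$ holds $g(k)$; - $R_T(\alpha)$ multiply a basis state by $e^{i\alpha}$ if two of its first $r$ slots are equal, and by $1$ otherwise; - $Q_x$ be the query that XORs $x_y$ into the last slot, and $u=Q_x\,U_B(\theta_2)\,Q_x\,U_A(\theta_1)$. Start from the uniform superposition of all $|S,y\rangle|0,\dots,0\rangle$, XOR the values $x_i$, $i\in S$, into the first $r$ slots ($r$ queries),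 apply $\big(u^{t}R_T(\alpha_2)\,u^{t}R_T(\alpha_1)\big)^{t_1}$ ($4t\,t_1$ queries), and measure; output the indices of two equal values among the first $r$ slots, or "all distinct" if there are none. -/

import Mathlib

open scoped Matrix Kronecker

noncomputable section

namespace ElementDistinctness

/-! ### The promise problem -/

/-- The string `x` is collision free, or it has exactly one colliding pair `{i, j}`. -/
def AtMostOneCollidingPair {N M : ℕ} (x : Fin N → Fin M) : Prop :=
  Function.Injective x ∨
    ∃ i j, i ≠ j ∧ x i = x j ∧
      ∀ k l, k ≠ l → x k = x l → (k = i ∧ l = j) ∨ (k = j ∧ l = i)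

/-- `none` stands for the answer "all distinct", `some (i, j)` for the indices of a colliding
pair. -/
def IsCorrect {N M : ℕ} (x : Fin N → Fin M) : Option (Fin N × Fin N) → Prop
  | none => Function.Injective x
  | some (i, j) => i ≠ j ∧ x i = x j

/-! ### Quantum query algorithms -/

/-- The contents of a register of `m` bits. -/
abbrev Bits (m : ℕ) : Type := Fin m → Bool

/-- The `m`-bit binary expansion of a value. -/
def encode {M : ℕ} (m : ℕ) (v : Fin M) : Bits m := fun k => v.val.testBit k

/-- Bitwise XOR. -/
def bxor {m : ℕ} (a b : Bits m) : Bits m := fun k => xor (a k) (b k)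

/-- A quantum query algorithm for strings of length `N` with entries stored in `m` bits. Its
computational basis states are `|i⟩|b⟩|w⟩`, with a query register `i`, an answer register `b` and
a finite workspace `w`. It starts in a fixed basis state, applies
`U 0, O_x, U 1, O_x, …, O_x, U queries`, where the unitaries do not depend on the input,
measures in the computational basis, and reads its answer off the outcome. -/
structure QueryAlgorithm (N m : ℕ) where
  Work : Type
  [fintypeWork : Fintype Work]
  [decEqWork : DecidableEq Work]
  queries : ℕ
  U : ℕ → Matrix.unitaryGroup (Fin N × Bits m × Work) ℂ
  start : Fin N × Bits m × Work
  out : Fin N × Bits m × Work → Option (Fin N × Fin N)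

attribute [instance] QueryAlgorithm.fintypeWork QueryAlgorithm.decEqWork

/-- The index oracle `O_x |i⟩|b⟩|w⟩ = |i⟩|b ⊕ x_i⟩|w⟩`. It permutes the basis by an involution, so
the amplitude of `O_x ψ` at a basis state is that of `ψ` at the image of this basis state. -/
def oracle {N M m : ℕ} {W : Type} (x : Fin N → Fin M) (ψ : Fin N × Bits m × W → ℂ) :
    Fin N × Bits m × W → ℂ :=
  fun z => ψ (z.1, bxor z.2.1 (encode m (x z.1)), z.2.2)

namespace QueryAlgorithm

variable {N m : ℕ}

abbrev Basis (A : QueryAlgorithm N m) : Type := Fin N × Bits m × A.Work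

/-- The state after `k` queries (and the unitary that follows the last of them). -/
def state {M : ℕ} (A : QueryAlgorithm N m) (x : Fin N → Fin M) : ℕ → A.Basis → ℂ
  | 0 => (A.U 0 : Matrix A.Basis A.Basis ℂ) *ᵥ Pi.single A.start 1
  | k + 1 => (A.U (k + 1) : Matrix A.Basis A.Basis ℂ) *ᵥ oracle x (A.state x k)

/-- The state that is measured. -/
def final {M : ℕ} (A : QueryAlgorithm N m) (x : Fin N → Fin M) : A.Basis → ℂ :=
  A.state x A.queries

open Classical in
/-- The probability that the answer is correct on the input `x`. -/
def successProb {M : ℕ} (A : QueryAlgorithm N m) (x : Fin N → Fin M) : ℝ :=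
  ∑ z : A.Basis, if IsCorrect x (A.out z) then ‖A.final x z‖ ^ 2 else 0

/-- The algorithm never errs on strings over `[M]` that satisfy the promise. -/
def SolvesExactly (A : QueryAlgorithm N m) (M : ℕ) : Prop :=
  ∀ x : Fin N → Fin M, AtMostOneCollidingPair x → A.successProb x = 1

end QueryAlgorithm

/-! ### The quantum walk on the quasi-Johnson graph -/

/-- The vertices `(S, y)` of the quasi-Johnson graph: `|S| = r` and `y ∉ S`. -/
abbrev Vertex (N r : ℕ) : Type := {p : Finset (Fin N) × Fin N // p.1.card = r ∧ p.2 ∉ p.1}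

/-- The basis `|S, y⟩|x'_1, …, x'_{r+1}⟩` of the two registers of the walk. -/
abbrev WalkBasis (N r m : ℕ) : Type := Vertex N r × (Fin (r + 1) → Bits m)

/-- The index to which a slot of the second register belongs: the first `r` slots belong to the
elements of `S` in ascending order, the last slot belongs to `y`. -/
def slotIndex {N r : ℕ} (v : Vertex N r) : Fin (r + 1) → Fin N :=
  Fin.snoc (α := fun _ => Fin N) (v.1.1.orderEmbOfFin v.2.1) v.1.2

/-- `|A_S⟩`, the uniform superposition of the vertices `(S, y)`, `y ∉ S`. -/
def ketA {N r : ℕ} (S : Finset (Fin N)) : Vertex N r → ℂ :=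
  fun v => if v.1.1 = S then 1 / (Real.sqrt ((N : ℝ) - r) : ℂ) else 0

/-- `U_A(θ) = I - (1 - e^{iθ}) ∑_S |A_S⟩⟨A_S|`. -/
def UA (N r : ℕ) (θ : ℝ) : Matrix (Vertex N r) (Vertex N r) ℂ :=
  1 - (1 - Complex.exp (θ * Complex.I)) •
    ∑ S ∈ Finset.powersetCard r (Finset.univ : Finset (Fin N)),
      Matrix.vecMulVec (ketA S) (star (ketA S))

/-- The uniform superposition of the vertices `(K \ {y}, y)`, `y ∈ K`, for an `(r+1)`-set `K`,
where for each `k` the value `g k` is stored in the slot that belongs to the `k`-th smallest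
element of `K`. -/
def ketB {N r : ℕ} (M m : ℕ) (K : {K : Finset (Fin N) // K.card = r + 1})
    (g : Fin (r + 1) → Fin M) : WalkBasis N r m → ℂ :=
  fun z =>
    if insert z.1.1.2 z.1.1.1 = K.1 ∧
        ∀ j k, slotIndex z.1 j = K.1.orderEmbOfFin K.2 k → z.2 j = encode m (g k)
    then 1 / (Real.sqrt ((r : ℝ) + 1) : ℂ) else 0

/-- `U_B^EXT(θ) = I - (1 - e^{iθ}) ∑_{K, g} |B_K^g⟩⟨B_K^g|`. -/
def UBext (N r M m : ℕ) (θ : ℝ) : Matrix (WalkBasis N r m) (WalkBasis N r m) ℂ :=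
  1 - (1 - Complex.exp (θ * Complex.I)) •
    ∑ K : {K : Finset (Fin N) // K.card = r + 1}, ∑ g : Fin (r + 1) → Fin M,
      Matrix.vecMulVec (ketB M m K g) (star (ketB M m K g))

/-- XOR the values `x_i`, `i ∈ S`, into the first `r` slots (`r` queries). -/
def loadS {N r M m : ℕ} (x : Fin N → Fin M) (ψ : WalkBasis N r m → ℂ) : WalkBasis N r m → ℂ :=
  fun z => ψ (z.1, fun j =>
    if j = Fin.last r then z.2 j else bxor (z.2 j) (encode m (x (slotIndex z.1 j))))

/-- XOR the value `x_y` into the last slot (one query). -/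
def loadY {N r M m : ℕ} (x : Fin N → Fin M) (ψ : WalkBasis N r m → ℂ) : WalkBasis N r m → ℂ :=
  fun z => ψ (z.1, fun j =>
    if j = Fin.last r then bxor (z.2 j) (encode m (x (slotIndex z.1 j))) else z.2 j)

/-- Two of the first `r` slots hold the same value. -/
def Marked {N r m : ℕ} (z : WalkBasis N r m) : Prop :=
  ∃ p : Fin r × Fin r, p.1 < p.2 ∧ z.2 p.1.castSucc = z.2 p.2.castSucc

open Classical in
/-- The marking operator `R_T(α)`. -/
def RT {N r m : ℕ} (α : ℝ) (ψ : WalkBasis N r m → ℂ) : WalkBasis N r m → ℂ :=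
  fun z => if Marked z then Complex.exp (α * Complex.I) * ψ z else ψ z

/-- The walk starts in the uniform superposition of all `|S, y⟩|0, …, 0⟩`. -/
def walkStart (N r m : ℕ) : WalkBasis N r m → ℂ :=
  fun z => if z.2 = fun _ _ => false
    then 1 / (Real.sqrt (Fintype.card (Vertex N r)) : ℂ) else 0

/-- The parameters of the walk: `outer` and `inner` are the numbers of iterations of the outer
loop and of each of the two inner loops in it. -/
structure WalkParams where
  θ₁ : ℝ
  θ₂ : ℝ
  α₁ : ℝ
  α₂ : ℝ
  outer : ℕ
  inner : ℕ

namespace WalkParams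

/-- One step of the walk (two queries). -/
def step {N r M m : ℕ} (P : WalkParams) (x : Fin N → Fin M) (ψ : WalkBasis N r m → ℂ) :
    WalkBasis N r m → ℂ :=
  loadY x (UBext N r M m P.θ₂ *ᵥ loadY x
    ((UA N r P.θ₁ ⊗ₖ (1 : Matrix (Fin (r + 1) → Bits m) (Fin (r + 1) → Bits m) ℂ)) *ᵥ ψ))

/-- One iteration of the outer loop. -/
def round {N r M m : ℕ} (P : WalkParams) (x : Fin N → Fin M) (ψ : WalkBasis N r m → ℂ) :
    WalkBasis N r m → ℂ :=
  (P.step x)^[P.inner] (RT P.α₂ ((P.step x)^[P.inner] (RT P.α₁ ψ)))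

/-- The state of the walk that is measured. -/
def final {N M : ℕ} (P : WalkParams) (r m : ℕ) (x : Fin N → Fin M) : WalkBasis N r m → ℂ :=
  (P.round x)^[P.outer] (loadS x (walkStart N r m))

/-- The number of queries made by the walk on `r`-subsets. -/
def queries (P : WalkParams) (r : ℕ) : ℕ := r + P.outer * (2 * P.inner + 2 * P.inner)

end WalkParams

open Classical in
/-- The answer read off the measured basis state of the walk: the indices of two equal values among
the first `r` slots, or "all distinct" if there are none. -/
def walkOut {N r m : ℕ} (z : WalkBasis N r m) : Option (Fin N × Fin N) :=
  if h : Marked z then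
    some (slotIndex z.1 h.choose.1.castSucc, slotIndex z.1 h.choose.2.castSucc)
  else none

/-- The query algorithm `A` carries out the walk on `r`-subsets with parameters `P` on strings over
`[M]`: it makes as many queries, and, up to an identification of the basis of the walk with basis
states of `A`, on every input it ends in the same state and answers in the same way. -/
def QueryAlgorithm.Implements {N m : ℕ} (A : QueryAlgorithm N m) (M r : ℕ) (P : WalkParams) :
    Prop :=
  A.queries = P.queries r ∧
    ∃ f : WalkBasis N r m → A.Basis, Function.Injective f ∧
      (∀ z, A.out (f z) = walkOut z) ∧
      ∀ x : Fin N → Fin M,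
        (∀ z, A.final x (f z) = P.final r m x z) ∧ ∀ a, a ∉ Set.range f → A.final x a = 0

end ElementDistinctness

end

noncomputable section

namespace ElementDistinctness

/-! ### Unitary matrices -/

section Unitary

variable {X ι : Type*} [Fintype X] [DecidableEq X]

/-! The slots of the second register always hold what the vertex and `x` dictate, so the walk
reduces to amplitudes on vertices (`final_eq_withSlots`). There one step is a product of two phase
rotations, about the ranges of the averaging projections A (over y, for fixed S) and B (over the
vertices with the same S ∪ {y}).

Let {i, j} be the only colliding pair. A fixes the constants, the sum of the indicators of i ∈ S and
j ∈ S, and the indicator of {i, j} ⊆ S; on their span AB is triangular with eigenvalues 1, 1 - μ₁, 1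
- μ₂, where μ_k = k(N+1-k)/((r+1)(N-r)). On each of the two nonconstant eigenvectors the step
satisfies a quadratic equation. For θ₁, θ₂ = π + η ± D its roots are e^{i(η ± δ_k)}, and the
condition on cos η and cos D is linear, so δ₁ and δ₂ can both be prescribed, within limits. If tδ₁
and tδ₂ are multiples of 2π, then t steps act on both eigenvectors as the scalar e^{itη} and on the
constants as e^{2itη}. Hence u^t is exactly a phase rotation about the constants in the plane of the
constants and the marked states (`vertexStep_pow_pairIndicator`). The multiples can be chosen with t
= O(√r) and with the relative phase tη = 2β close to an odd multiple of π (`exists_arePhases`).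

What remains is amplitude amplification in a plane, with a given phase 2β and two free marking
phases per round. One of them is spent on making the normalized diagonal entry of a round real; the
unmarked amplitude after n rounds is then, up to a nonzero factor, a real Chebyshev-like sequence,
continuous in the other phase. It is nonpositive for matching phases and nonnegative when the first
marking is switched off, so it vanishes somewhere in between (`exists_marking_phases`,
`vertexRound_iterate_eq_zero`).

The parameters depend on `x` nowhere, because the eigenvalues and the marked fraction depend on N
and r alone. On a collision-free string the walk never answers wrongly, whatever its phases. With n
= O(N/r) rounds the cost r + O(N/√r) is O(N^{2/3}) for r = ⌊N^{2/3}⌋. For N < 5 all entries are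
queried. -/

lemma permMatrix_mem_unitaryGroup (σ : Equiv.Perm X) :
    σ.permMatrix ℂ ∈ Matrix.unitaryGroup X ℂ := by
  rw [Matrix.mem_unitaryGroup_iff, Matrix.star_eq_conjTranspose, Matrix.conjTranspose_permMatrix,
    ← Matrix.permMatrix_mul]
  simp

/-- Every unit vector is the image of a given basis vector under some unitary. -/
lemma exists_unitary_mulVec_single (z : X) (ψ : X → ℂ) (hψ : ∑ i, ‖ψ i‖ ^ 2 = 1) :
    ∃ U : Matrix.unitaryGroup X ℂ, (U : Matrix X X ℂ) *ᵥ Pi.single z 1 = ψ := by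
  have hn : ‖WithLp.toLp 2 ψ‖ = 1 := by
    rw [EuclideanSpace.norm_eq]
    simp [hψ]
  -- The one-vector family at index `z` extends to an orthonormal basis indexed by `X`; its matrix
  -- has `ψ` as column `z`.
  have ho : Orthonormal ℂ (({z} : Set X).domRestrict fun _ : X => WithLp.toLp 2 ψ) := by
    refine ⟨fun i => hn, fun i j hij => ?_⟩
    exact absurd (Subsingleton.elim i j) hij
  obtain ⟨b, hb⟩ := ho.exists_orthonormalBasis_extension_of_card_eq (by simp)
  refine ⟨⟨(EuclideanSpace.basisFun X ℂ).toBasis.toMatrix b,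
    (EuclideanSpace.basisFun X ℂ).toMatrix_orthonormalBasis_mem_unitary b⟩, ?_⟩
  ext i
  simp [Module.Basis.toMatrix_apply, hb z rfl]

lemma sum_norm_sq_mulVec (U : Matrix.unitaryGroup X ℂ) (ψ : X → ℂ) :
    ∑ i, ‖((U : Matrix X X ℂ) *ᵥ ψ) i‖ ^ 2 = ∑ i, ‖ψ i‖ ^ 2 := by
  have key : ∀ φ : X → ℂ, ((∑ i, ‖φ i‖ ^ 2 : ℝ) : ℂ) = star φ ⬝ᵥ φ := by
    intro φ
    simp [dotProduct, Complex.conj_mul']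
  apply Complex.ofReal_injective
  rw [key, key, Matrix.star_mulVec, ← Matrix.dotProduct_mulVec, Matrix.mulVec_mulVec,
    ← Matrix.star_eq_conjTranspose, Matrix.UnitaryGroup.star_mul_self, Matrix.one_mulVec]

/-- A phase rotation `I - (1 - e^{iθ}) Π` on the span of an orthonormal family is unitary. -/
lemma one_sub_smul_sum_vecMulVec_mem_unitaryGroup [DecidableEq ι] (s : Finset ι)
    (v : ι → X → ℂ)
    (hv : ∀ i ∈ s, ∀ j ∈ s, star (v i) ⬝ᵥ v j = if i = j then 1 else 0) (θ : ℝ) :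
    (1 - (1 - Complex.exp (θ * Complex.I)) • ∑ i ∈ s, Matrix.vecMulVec (v i) (star (v i)) :
      Matrix X X ℂ) ∈ Matrix.unitaryGroup X ℂ := by
  set P : Matrix X X ℂ := ∑ i ∈ s, Matrix.vecMulVec (v i) (star (v i)) with hP
  have hPs : star P = P := by
    rw [hP, star_sum]
    refine Finset.sum_congr rfl fun i _ => ?_
    rw [Matrix.star_eq_conjTranspose, Matrix.conjTranspose_vecMulVec, star_star]
  have hPP : P * P = P := by
    rw [hP, Finset.sum_mul_sum]
    refine Finset.sum_congr rfl fun i hi => ?_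
    rw [Finset.sum_eq_single i]
    · rw [Matrix.vecMulVec_mul_vecMulVec, hv i hi i hi]
      simp
    · intro j hj hji
      rw [Matrix.vecMulVec_mul_vecMulVec, hv i hi j hj, if_neg (Ne.symm hji)]
      simp
    · intro h
      exact absurd hi h
  set c := Complex.exp (θ * Complex.I) with hc
  have hcc : c * star c = 1 := by
    rw [Complex.star_def, Complex.mul_conj, Complex.normSq_eq_norm_sq, hc,
      Complex.norm_exp_ofReal_mul_I]
    simp
  rw [Matrix.mem_unitaryGroup_iff, star_sub, star_one, star_smul, hPs, mul_sub, sub_mul, sub_mul]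
  simp only [mul_one, one_mul, Matrix.smul_mul, Matrix.mul_smul, hPP, smul_smul]
  -- For |c| = 1 this is the identity |1 - c|² = 2 Re (1 - c).
  have h2 : (1 - c) + (star (1 - c)) - star (1 - c) * (1 - c) = 0 := by
    rw [star_sub, star_one]
    linear_combination -hcc
  have h3 : (1 : Matrix X X ℂ) - (1 - c) • P - (star (1 - c) • P - (star (1 - c) * (1 - c)) • P)
      = 1 - ((1 - c) + (star (1 - c)) - star (1 - c) * (1 - c)) • P := by
    module
  rw [h3, h2]
  simp

lemma diagonal_mem_unitaryGroup (d : X → ℂ) (hd : ∀ i, ‖d i‖ = 1) :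
    Matrix.diagonal d ∈ Matrix.unitaryGroup X ℂ := by
  rw [Matrix.mem_unitaryGroup_iff, Matrix.star_eq_conjTranspose, Matrix.diagonal_conjTranspose,
    Matrix.diagonal_mul_diagonal]
  rw [← Matrix.diagonal_one]
  congr 1
  ext i
  simp [Complex.mul_conj, Complex.normSq_eq_norm_sq, hd i]

end Unitary

/-! ### Query programs on slots -/

lemma bxor_bxor_cancel {m : ℕ} (a b : Bits m) : bxor (bxor a b) b = a := by
  ext k
  simp [bxor]

lemma encode_injective {M m : ℕ} (hM : M ≤ 2 ^ m) :
    Function.Injective (encode m : Fin M → Bits m) := by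
  intro a b h
  apply Fin.ext
  apply Nat.eq_of_testBit_eq
  intro i
  by_cases hi : i < m
  · exact congrFun h ⟨i, hi⟩
  · have hp : 2 ^ m ≤ 2 ^ i := Nat.pow_le_pow_right (by norm_num) (not_lt.1 hi)
    rw [Nat.testBit_lt_two_pow (lt_of_lt_of_le a.2 (hM.trans hp)),
      Nat.testBit_lt_two_pow (lt_of_lt_of_le b.2 (hM.trans hp))]

section Programs

variable {N M m n : ℕ} {V : Type}

/-- XOR the value with index `idx v j` into slot `j`, where `v` is the content of the first
register. -/
def loadSlot (idx : V → Fin n → Fin N) (j : Fin n) (x : Fin N → Fin M)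
    (ψ : V × (Fin n → Bits m) → ℂ) : V × (Fin n → Bits m) → ℂ :=
  fun z => ψ (z.1, Function.update z.2 j (bxor (z.2 j) (encode m (x (idx z.1 j)))))

/-- XOR the values with indices `idx v j`, `j < k`, into the slots `j < k`. -/
def loadBelow (idx : V → Fin n → Fin N) (k : ℕ) (x : Fin N → Fin M)
    (ψ : V × (Fin n → Bits m) → ℂ) : V × (Fin n → Bits m) → ℂ :=
  fun z => ψ (z.1, fun j =>
    if (j : ℕ) < k then bxor (z.2 j) (encode m (x (idx z.1 j))) else z.2 j)

variable [Fintype V] [DecidableEq V]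

/-- `QueryProgram idx k F`: on every input `x`, the operator `F x` is a product of `k` slot queries
and of unitaries that do not depend on the input. -/
inductive QueryProgram (idx : V → Fin n → Fin N) : ℕ →
    ((Fin N → Fin M) → (V × (Fin n → Bits m) → ℂ) → V × (Fin n → Bits m) → ℂ) → Prop
  | unitary (U : Matrix.unitaryGroup (V × (Fin n → Bits m)) ℂ) :
      QueryProgram idx 0 fun _ ψ => (U : Matrix _ _ ℂ) *ᵥ ψ
  | query {k : ℕ}
      {F : (Fin N → Fin M) → (V × (Fin n → Bits m) → ℂ) → V × (Fin n → Bits m) → ℂ}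
      (j : Fin n) (U : Matrix.unitaryGroup (V × (Fin n → Bits m)) ℂ)
      (hF : QueryProgram idx k F) :
      QueryProgram idx (k + 1) fun x ψ => (U : Matrix _ _ ℂ) *ᵥ loadSlot idx j x (F x ψ)

namespace QueryProgram

variable {idx : V → Fin n → Fin N}
  {F G : (Fin N → Fin M) → (V × (Fin n → Bits m) → ℂ) → V × (Fin n → Bits m) → ℂ} {k l : ℕ}

lemma id : QueryProgram (M := M) (m := m) idx 0 fun _ ψ => ψ := by
  simpa using QueryProgram.unitary (M := M) (m := m) (idx := idx) 1

lemma unitary_comp (U : Matrix.unitaryGroup (V × (Fin n → Bits m)) ℂ)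
    (hF : QueryProgram idx k F) :
    QueryProgram idx k fun x ψ => (U : Matrix _ _ ℂ) *ᵥ F x ψ := by
  cases hF with
  | unitary U' => simpa using QueryProgram.unitary (M := M) (idx := idx) (U * U')
  | query j U' hF => simpa using QueryProgram.query j (U * U') hF

lemma comp (hG : QueryProgram idx l G) (hF : QueryProgram idx k F) :
    QueryProgram idx (k + l) fun x ψ => G x (F x ψ) := by
  induction hG with
  | unitary U => exact hF.unitary_comp U
  | query j U _ ih => exact ih.query j U

lemma iterate (hF : QueryProgram idx k F) (l : ℕ) :
    QueryProgram idx (l * k) fun x ψ => (F x)^[l] ψ := by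
  induction l with
  | zero => simpa using QueryProgram.id
  | succ l ih =>
    have h := hF.comp ih
    simp only [Function.iterate_succ_apply']
    rwa [Nat.succ_mul]

lemma loadSlot (j : Fin n) :
    QueryProgram (M := M) (m := m) idx 1 (ElementDistinctness.loadSlot idx j) := by
  simpa using QueryProgram.query j 1 (QueryProgram.id (M := M) (m := m) (idx := idx))

lemma loadBelow (hk : k ≤ n) :
    QueryProgram (M := M) (m := m) idx k (ElementDistinctness.loadBelow idx k) := by
  induction k with
  | zero =>
    have h : ElementDistinctness.loadBelow (M := M) (m := m) idx 0 = fun _ ψ => ψ := by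
      funext x ψ z
      simp [ElementDistinctness.loadBelow]
    rw [h]
    exact QueryProgram.id
  | succ k ih =>
    have h := (QueryProgram.loadSlot (M := M) (m := m) (idx := idx) ⟨k, hk⟩).comp
      (ih (by omega))
    convert h using 1
    funext x ψ z
    simp only [ElementDistinctness.loadBelow, ElementDistinctness.loadSlot]
    congr 2
    funext j
    rcases lt_trichotomy (j : ℕ) k with hj | hj | hj
    · have : j ≠ ⟨k, hk⟩ := fun h => by simp [h] at hj
      simp [this, hj, hj.trans (Nat.lt_succ_self k)]
    · have : j = ⟨k, hk⟩ := Fin.ext hj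
      subst this
      simp
    · have : j ≠ ⟨k, hk⟩ := fun h => by simp [h] at hj
      simp [this, hj.not_gt, show ¬ (j : ℕ) < k + 1 by omega]

end QueryProgram

/-- The basis permutation that moves the contents of slot `j` to the answer register and the index
of this slot to the query register. -/
def exposeSlot [NeZero N] (idx : V → Fin n → Fin N) (j : Fin n) :
    Equiv.Perm (Fin N × Bits m × V × (Fin n → Bits m)) where
  -- Adding the index, instead of overwriting the register, keeps the map reversible; on a register
  -- at 0 the effect is the same.
  toFun a := (a.1 + idx a.2.2.1 j, a.2.2.2 j, a.2.2.1, Function.update a.2.2.2 j a.2.1)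
  invFun a := (a.1 - idx a.2.2.1 j, a.2.2.2 j, a.2.2.1, Function.update a.2.2.2 j a.2.1)
  left_inv a := by simp
  right_inv a := by simp

/-- The state `|0⟩|0⟩ ⊗ ψ`. -/
def withBlankQuery [NeZero N] {X : Type} (ψ : X → ℂ) : Fin N × Bits m × X → ℂ :=
  fun a => if a.1 = 0 ∧ a.2.1 = (fun _ => false) then ψ a.2.2 else 0

/-- A slot query is an index query conjugated by the exposing permutation. The inverse appears
because a permutation matrix acts on amplitudes by precomposition, so that the matrix of the inverse
moves basis states forward. -/
lemma exposeSlot_oracle [NeZero N] (idx : V → Fin n → Fin N) (j : Fin n) (x : Fin N → Fin M)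
    (ψ : V × (Fin n → Bits m) → ℂ) :
    (((exposeSlot idx j)⁻¹ : Equiv.Perm _).permMatrix ℂ)ᴴ *ᵥ oracle x
      (((exposeSlot idx j)⁻¹ : Equiv.Perm _).permMatrix ℂ *ᵥ withBlankQuery ψ) =
    withBlankQuery (N := N) (m := m) (loadSlot idx j x ψ) := by
  rw [Matrix.conjTranspose_permMatrix, inv_inv, Matrix.permMatrix_mulVec,
    Matrix.permMatrix_mulVec]
  funext ⟨i, b, v, s⟩
  simp only [Function.comp_apply, oracle, withBlankQuery, loadSlot, exposeSlot, Equiv.coe_fn_mk,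
    Equiv.Perm.inv_def, Equiv.symm]
  by_cases hi : i = 0
  · subst hi
    simp
  · simp [hi]

lemma one_kronecker_mulVec_withBlankQuery [NeZero N] {X : Type} [Fintype X] [DecidableEq X]
    (U : Matrix X X ℂ) (ψ : X → ℂ) :
    ((1 : Matrix (Fin N) (Fin N) ℂ) ⊗ₖ ((1 : Matrix (Bits m) (Bits m) ℂ) ⊗ₖ U)) *ᵥ
      withBlankQuery ψ = withBlankQuery (U *ᵥ ψ) := by
  funext ⟨i, b, z⟩
  simp only [Matrix.mulVec, dotProduct, Fintype.sum_prod_type, Matrix.kroneckerMap_apply,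
    withBlankQuery, Matrix.one_apply]
  rw [Finset.sum_eq_single i (by intro c _ hc; simp [Ne.symm hc]) (by simp)]
  rw [Finset.sum_eq_single b (by intro c _ hc; simp [Ne.symm hc]) (by simp)]
  by_cases h : i = 0 ∧ b = fun _ => false <;> simp [h]

/-- Appending a query to an algorithm changes only its last unitary and those after it; the state
before that is untouched. -/
lemma QueryAlgorithm.state_congr (W : Type) [Fintype W] [DecidableEq W] (q q' : ℕ)
    (U U' : ℕ → Matrix.unitaryGroup (Fin N × Bits m × W) ℂ) (start out)
    (x : Fin N → Fin M) (k : ℕ) (h : ∀ i ≤ k, U i = U' i) :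
    (QueryAlgorithm.mk W q U start out).state x k =
      (QueryAlgorithm.mk W q' U' start out).state x k := by
  induction k with
  | zero => simp only [QueryAlgorithm.state, h 0 le_rfl]
  | succ k ih =>
    simp only [QueryAlgorithm.state, h (k + 1) le_rfl]
    rw [ih fun i hi => h i (by omega)]

/-- Every program with `k` slot queries is carried out by an algorithm with `k` queries. -/
lemma QueryProgram.exists_state_eq [NeZero N] {idx : V → Fin n → Fin N} {k : ℕ}
    {F : (Fin N → Fin M) → (V × (Fin n → Bits m) → ℂ) → V × (Fin n → Bits m) → ℂ}
    (hF : QueryProgram idx k F) (z : V × (Fin n → Bits m)) (out) :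
    ∃ U : ℕ → Matrix.unitaryGroup (Fin N × Bits m × V × (Fin n → Bits m)) ℂ,
      ∀ x : Fin N → Fin M,
        (QueryAlgorithm.mk (V × (Fin n → Bits m)) k U (0, (fun _ => false), z) out).state x k =
          withBlankQuery (F x (Pi.single z 1)) := by
  have hlift : ∀ U : Matrix.unitaryGroup (V × (Fin n → Bits m)) ℂ,
      ((1 : Matrix (Fin N) (Fin N) ℂ) ⊗ₖ ((1 : Matrix (Bits m) (Bits m) ℂ) ⊗ₖ U.1)) ∈
        Matrix.unitaryGroup (Fin N × Bits m × V × (Fin n → Bits m)) ℂ := fun U =>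
    Matrix.kronecker_mem_unitary (one_mem _) (Matrix.kronecker_mem_unitary (one_mem _) U.2)
  induction hF with
  | unitary U =>
    refine ⟨fun _ => ⟨_, hlift U⟩, fun x => ?_⟩
    rw [← one_kronecker_mulVec_withBlankQuery]
    simp only [QueryAlgorithm.state]
    congr 1
    funext ⟨i, b, y⟩
    by_cases h : i = 0 <;> by_cases h' : b = (fun _ => false) <;>
      simp [withBlankQuery, Pi.single_apply, h, h']
  | @query k F j U hF ih =>
    obtain ⟨W, hW⟩ := ih
    set σ := ((exposeSlot (m := m) idx j)⁻¹ : Equiv.Perm _).permMatrix ℂ with hσ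
    let S : Matrix.unitaryGroup (Fin N × Bits m × V × (Fin n → Bits m)) ℂ :=
      ⟨σ, permMatrix_mem_unitaryGroup _⟩
    -- The exposing permutation is absorbed into the unitary before the new query, its inverse into
    -- the unitary after it.
    let W' : ℕ → Matrix.unitaryGroup (Fin N × Bits m × V × (Fin n → Bits m)) ℂ := fun i =>
      if i = k then S * W k else if i = k + 1 then ⟨_, hlift U⟩ * S⁻¹ else W i
    refine ⟨W', fun x => ?_⟩
    have h1 : (QueryAlgorithm.mk (V × (Fin n → Bits m)) (k + 1) W'
        (0, (fun _ => false), z) out).state x k = σ *ᵥ withBlankQuery (F x (Pi.single z 1)) := by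
      rw [← hW x]
      cases k with
      | zero =>
        simp only [QueryAlgorithm.state, W', S, if_true, Matrix.UnitaryGroup.mul_val]
        rw [Matrix.mulVec_mulVec]
      | succ k =>
        simp only [QueryAlgorithm.state]
        rw [QueryAlgorithm.state_congr _ _ (k + 1) W' W]
        · simp [W', S]
        · intro i hi
          simp [W', show i ≠ k + 1 by omega, show i ≠ k + 1 + 1 by omega]
    have h2 : (QueryAlgorithm.mk (V × (Fin n → Bits m)) (k + 1) W'
        (0, (fun _ => false), z) out).state x (k + 1) = (W' (k + 1) : Matrix _ _ ℂ) *ᵥ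
          oracle x (σ *ᵥ withBlankQuery (F x (Pi.single z 1))) := by
      rw [← h1]
      rfl
    rw [h2]
    have h3 : (W' (k + 1) : Matrix _ _ ℂ) =
        ((1 : Matrix (Fin N) (Fin N) ℂ) ⊗ₖ ((1 : Matrix (Bits m) (Bits m) ℂ) ⊗ₖ U.1)) * σᴴ := by
      simp only [W', S, show k + 1 ≠ k by omega, if_true, if_false]
      rfl
    rw [h3, ← Matrix.mulVec_mulVec, exposeSlot_oracle, one_kronecker_mulVec_withBlankQuery]

end Programs

/-! ### Exactness -/

lemma QueryAlgorithm.sum_norm_sq_state {N M m : ℕ} (A : QueryAlgorithm N m) (x : Fin N → Fin M)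
    (k : ℕ) : ∑ z, ‖A.state x k z‖ ^ 2 = 1 := by
  induction k with
  | zero =>
    rw [QueryAlgorithm.state, sum_norm_sq_mulVec]
    rw [Finset.sum_eq_single A.start] <;> simp +contextual
  | succ k ih =>
    rw [QueryAlgorithm.state, sum_norm_sq_mulVec, ← ih]
    refine Fintype.sum_equiv (Function.Involutive.toPerm
      (fun z : A.Basis => (z.1, bxor z.2.1 (encode m (x z.1)), z.2.2)) ?_) _ _ fun z => rfl
    intro z
    simp [bxor_bxor_cancel]

/-- The total weight is 1 by unitarity, so exactness only concerns the support of the final state.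
-/
lemma QueryAlgorithm.successProb_eq_one {N M m : ℕ} (A : QueryAlgorithm N m) (x : Fin N → Fin M)
    (h : ∀ z, A.final x z ≠ 0 → IsCorrect x (A.out z)) : A.successProb x = 1 := by
  rw [QueryAlgorithm.successProb, ← A.sum_norm_sq_state x A.queries]
  refine Finset.sum_congr rfl fun z _ => ?_
  split_ifs with hz
  · rfl
  · have : A.final x z = 0 := not_not.1 fun h' => hz (h z h')
    rw [QueryAlgorithm.final] at this
    simp [this]

/-- The classical algorithm that queries all indices. -/
lemma exists_solvesExactly_with_queries_eq {N M m : ℕ} (hN : 1 ≤ N) (hM : M ≤ 2 ^ m) :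
    ∃ A : QueryAlgorithm N m, A.SolvesExactly M ∧ A.queries = N := by
  classical
  have : NeZero N := ⟨by omega⟩
  let out : Fin N × Bits m × Unit × (Fin N → Bits m) → Option (Fin N × Fin N) := fun a =>
    if h : ∃ p : Fin N × Fin N, p.1 ≠ p.2 ∧ a.2.2.2 p.1 = a.2.2.2 p.2 then some h.choose else none
  obtain ⟨U, hU⟩ := (QueryProgram.loadBelow (M := M) (m := m) (idx := fun (_ : Unit) i => i)
    (le_refl N)).exists_state_eq ((), fun _ _ => false) out
  refine ⟨QueryAlgorithm.mk (Unit × (Fin N → Bits m)) N U (0, (fun _ => false), (), fun _ _ => false)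
    out, fun x _ => QueryAlgorithm.successProb_eq_one _ x ?_, rfl⟩
  rintro ⟨i, b, u, s⟩ hz
  have hs : s = fun j => encode m (x j) := by
    by_contra hs
    apply hz
    rw [QueryAlgorithm.final, hU x]
    simp only [withBlankQuery, loadBelow, Fin.is_lt, if_true]
    split_ifs
    · rw [Pi.single_apply, if_neg]
      intro h
      apply hs
      funext j
      have := congrFun (congrArg Prod.snd h) j
      simp only at this
      rw [← bxor_bxor_cancel (s j) (encode m (x j)), this]
      funext k
      simp [bxor]
    · rfl
  subst hs
  show IsCorrect x (out _)
  simp only [out]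
  split_ifs with h
  · exact ⟨h.choose_spec.1, encode_injective hM h.choose_spec.2⟩
  · intro j k hjk
    by_contra hne
    exact h ⟨(j, k), hne, by simp [hjk]⟩

/-! ### Slots and vertices -/

section Slots

variable {N r M m : ℕ}

@[simp] lemma slotIndex_last (v : Vertex N r) : slotIndex v (Fin.last r) = v.1.2 := by
  simp [slotIndex]

@[simp] lemma slotIndex_castSucc (v : Vertex N r) (j : Fin r) :
    slotIndex v j.castSucc = v.1.1.orderEmbOfFin v.2.1 j := by
  simp [slotIndex]

lemma slotIndex_castSucc_mem (v : Vertex N r) (j : Fin r) : slotIndex v j.castSucc ∈ v.1.1 := by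
  simp

lemma exists_slotIndex_castSucc_eq (v : Vertex N r) {i : Fin N} (hi : i ∈ v.1.1) :
    ∃ j : Fin r, slotIndex v j.castSucc = i := by
  have : i ∈ Set.range (v.1.1.orderEmbOfFin v.2.1) := by simpa using hi
  obtain ⟨j, hj⟩ := this
  exact ⟨j, by rw [slotIndex_castSucc, hj]⟩

lemma slotIndex_castSucc_congr {v w : Vertex N r} (h : v.1.1 = w.1.1) (j : Fin r) :
    slotIndex v j.castSucc = slotIndex w j.castSucc := by
  simp only [slotIndex_castSucc]
  congr

lemma slotIndex_mem_insert (v : Vertex N r) (j : Fin (r + 1)) :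
    slotIndex v j ∈ insert v.1.2 v.1.1 := by
  refine Fin.lastCases ?_ (fun j => ?_) j
  · simp
  · exact Finset.mem_insert_of_mem (slotIndex_castSucc_mem v j)

lemma exists_slotIndex_eq (v : Vertex N r) {i : Fin N} (hi : i ∈ insert v.1.2 v.1.1) :
    ∃ j, slotIndex v j = i := by
  rcases Finset.mem_insert.1 hi with rfl | hi
  · exact ⟨_, slotIndex_last v⟩
  · obtain ⟨j, hj⟩ := exists_slotIndex_castSucc_eq v hi
    exact ⟨_, hj⟩

lemma card_insert_vertex (v : Vertex N r) : (insert v.1.2 v.1.1).card = r + 1 := by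
  rw [Finset.card_insert_of_notMem v.2.2, v.2.1]

lemma sum_vertex_same_set {S : Finset (Fin N)} (hS : S.card = r)
    (h : Finset (Fin N) → Fin N → ℂ) :
    (∑ w : Vertex N r, if w.1.1 = S then h w.1.1 w.1.2 else 0) = ∑ y ∈ Sᶜ, h S y := by
  rw [← Finset.sum_filter]
  refine Finset.sum_bij' (fun w _ => w.1.2)
    (fun y hy => ⟨(S, y), hS, Finset.mem_compl.1 hy⟩) ?_ ?_ ?_ ?_ ?_
  · rintro ⟨⟨T, y⟩, hT, hy⟩ hw
    simp only [Finset.mem_filter, Finset.mem_univ, true_and] at hw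
    subst hw
    simpa using hy
  · intro y hy
    simp
  · rintro ⟨⟨T, y⟩, hT, hy⟩ hw
    simp only [Finset.mem_filter, Finset.mem_univ, true_and] at hw
    subst hw
    rfl
  · intro y hy
    rfl
  · rintro ⟨⟨T, y⟩, hT, hy⟩ hw
    simp only [Finset.mem_filter, Finset.mem_univ, true_and] at hw
    subst hw
    rfl

lemma sum_vertex_same_insert {K : Finset (Fin N)} (hK : K.card = r + 1)
    (h : Finset (Fin N) → Fin N → ℂ) :
    (∑ w : Vertex N r, if insert w.1.2 w.1.1 = K then h w.1.1 w.1.2 else 0) =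
      ∑ y ∈ K, h (K.erase y) y := by
  rw [← Finset.sum_filter]
  refine Finset.sum_bij' (fun w _ => w.1.2)
    (fun y hy => ⟨(K.erase y, y), by rw [Finset.card_erase_of_mem hy, hK]; rfl,
      Finset.notMem_erase y K⟩) ?_ ?_ ?_ ?_ ?_
  · rintro ⟨⟨T, y⟩, hT, hy⟩ hw
    simp only [Finset.mem_filter, Finset.mem_univ, true_and] at hw
    subst hw
    simp
  · intro y hy
    simp [Finset.insert_erase hy]
  · rintro ⟨⟨T, y⟩, hT, hy⟩ hw
    simp only [Finset.mem_filter, Finset.mem_univ, true_and] at hw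
    subst hw
    simp only at hy
    simp [Finset.erase_insert hy]
  · intro y hy
    rfl
  · rintro ⟨⟨T, y⟩, hT, hy⟩ hw
    simp only [Finset.mem_filter, Finset.mem_univ, true_and] at hw
    subst hw
    simp only at hy
    simp [Finset.erase_insert hy]

/-- All slots of `v` hold the values of the string `x`. -/
def fullSlots (m : ℕ) (x : Fin N → Fin M) (v : Vertex N r) : Fin (r + 1) → Bits m :=
  fun j => encode m (x (slotIndex v j))

/-- The first `r` slots of `v` hold the values of the string `x`, the last one is blank. -/
def setSlots (m : ℕ) (x : Fin N → Fin M) (v : Vertex N r) : Fin (r + 1) → Bits m :=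
  fun j => if j = Fin.last r then fun _ => false else encode m (x (slotIndex v j))

/-- With the last slot blank the contents do not depend on y. This is why U_A, which moves y without
touching the slots, keeps them consistent with the vertex. -/
lemma setSlots_congr (x : Fin N → Fin M) {v w : Vertex N r} (h : v.1.1 = w.1.1) :
    setSlots m x v = setSlots m x w := by
  funext j
  refine Fin.lastCases ?_ (fun j => ?_) j
  · simp [setSlots]
  · rw [setSlots, setSlots, slotIndex_castSucc_congr h]

/-- The walk state with amplitude `φ v` at the vertex `v`, with the slots determined by `v`. -/
def withSlots (s : Vertex N r → Fin (r + 1) → Bits m) (φ : Vertex N r → ℂ) :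
    WalkBasis N r m → ℂ :=
  fun z => if z.2 = s z.1 then φ z.1 else 0

lemma loadS_walkStart (x : Fin N → Fin M) :
    loadS x (walkStart N r m) = withSlots (setSlots m x)
      fun _ => 1 / (Real.sqrt (Fintype.card (Vertex N r)) : ℂ) := by
  funext ⟨v, s⟩
  simp only [loadS, walkStart, withSlots]
  congr 1
  rw [funext_iff, funext_iff, eq_iff_iff]
  refine forall_congr' fun j => ?_
  by_cases hj : j = Fin.last r
  · simp [hj, setSlots]
  · simp only [hj, if_false, setSlots]
    constructor
    · intro h
      rw [← bxor_bxor_cancel (s j) (encode m (x (slotIndex v j))), h]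
      funext k
      simp [bxor]
    · intro h
      rw [h]
      funext k
      simp [bxor]

lemma bxor_eq_iff {a b c : Bits m} : bxor a b = c ↔ a = bxor c b := by
  constructor
  · rintro rfl
    rw [bxor_bxor_cancel]
  · rintro rfl
    rw [bxor_bxor_cancel]

lemma loadY_withSlots_setSlots (x : Fin N → Fin M) (φ : Vertex N r → ℂ) :
    loadY x (withSlots (setSlots m x) φ) = withSlots (fullSlots m x) φ := by
  funext ⟨v, s⟩
  simp only [loadY, withSlots]
  congr 1
  rw [funext_iff, funext_iff, eq_iff_iff]
  refine forall_congr' fun j => ?_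
  by_cases hj : j = Fin.last r
  · subst hj
    simp only [if_true, setSlots, fullSlots, bxor_eq_iff]
    constructor <;> (intro h; rw [h]; funext k; simp [bxor])
  · simp [hj, setSlots, fullSlots]

lemma loadY_withSlots_fullSlots (x : Fin N → Fin M) (φ : Vertex N r → ℂ) :
    loadY x (withSlots (fullSlots m x) φ) = withSlots (setSlots m x) φ := by
  rw [← loadY_withSlots_setSlots]
  funext ⟨v, s⟩
  simp only [loadY]
  congr 2
  funext j
  by_cases hj : j = Fin.last r <;> simp [hj, bxor_bxor_cancel]

/-! ### The averaging projections -/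

/-- The mean over all vertices with the same set `S`. -/
def avgA (N r : ℕ) : (Vertex N r → ℂ) →ₗ[ℂ] (Vertex N r → ℂ) where
  toFun φ v := ((N : ℂ) - r)⁻¹ * ∑ w : Vertex N r, if w.1.1 = v.1.1 then φ w else 0
  map_add' φ χ := by
    funext v
    simp only [Pi.add_apply, ← mul_add, ← Finset.sum_add_distrib]
    congr 1
    refine Finset.sum_congr rfl fun w _ => ?_
    split_ifs <;> simp
  map_smul' c φ := by
    funext v
    simp only [Pi.smul_apply, smul_eq_mul, RingHom.id_apply, Finset.mul_sum]
    refine Finset.sum_congr rfl fun w _ => ?_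
    split_ifs <;> ring

/-- The mean over all vertices with the same set `S ∪ {y}`. -/
def avgB (N r : ℕ) : (Vertex N r → ℂ) →ₗ[ℂ] (Vertex N r → ℂ) where
  toFun φ v := ((r : ℂ) + 1)⁻¹ *
    ∑ w : Vertex N r, if insert w.1.2 w.1.1 = insert v.1.2 v.1.1 then φ w else 0
  map_add' φ χ := by
    funext v
    simp only [Pi.add_apply, ← mul_add, ← Finset.sum_add_distrib]
    congr 1
    refine Finset.sum_congr rfl fun w _ => ?_
    split_ifs <;> simp
  map_smul' c φ := by
    funext v
    simp only [Pi.smul_apply, smul_eq_mul, RingHom.id_apply, Finset.mul_sum]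
    refine Finset.sum_congr rfl fun w _ => ?_
    split_ifs <;> ring

lemma avgA_apply (h : Finset (Fin N) → Fin N → ℂ) (v : Vertex N r) :
    avgA N r (fun w => h w.1.1 w.1.2) v = ((N : ℂ) - r)⁻¹ * ∑ y ∈ v.1.1ᶜ, h v.1.1 y := by
  rw [← sum_vertex_same_set v.2.1]
  rfl

lemma avgB_apply (h : Finset (Fin N) → Fin N → ℂ) (v : Vertex N r) :
    avgB N r (fun w => h w.1.1 w.1.2) v =
      ((r : ℂ) + 1)⁻¹ * ∑ y ∈ insert v.1.2 v.1.1, h ((insert v.1.2 v.1.1).erase y) y := by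
  rw [← sum_vertex_same_insert (card_insert_vertex v)]
  rfl

lemma avgA_eq_self (hr : r < N) (h : Finset (Fin N) → ℂ) :
    avgA N r (fun w => h w.1.1) = fun w => h w.1.1 := by
  funext v
  rw [avgA_apply (fun S _ => h S), Finset.sum_const, Finset.card_compl, v.2.1, Fintype.card_fin,
    nsmul_eq_mul, Nat.cast_sub hr.le]
  have : (N : ℂ) - r ≠ 0 := by
    rw [sub_ne_zero]
    exact_mod_cast hr.ne'
  field_simp

lemma avgB_eq_self (h : Finset (Fin N) → ℂ) :
    avgB N r (fun w => h (insert w.1.2 w.1.1)) = fun w => h (insert w.1.2 w.1.1) := by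
  funext v
  rw [avgB_apply (fun S y => h (insert y S)), Finset.sum_congr rfl fun y hy => by
    rw [Finset.insert_erase hy], Finset.sum_const, card_insert_vertex, nsmul_eq_mul]
  have : (r : ℂ) + 1 ≠ 0 := by exact_mod_cast Nat.succ_ne_zero r
  push_cast
  field_simp

/-! ### The operators of the walk -/

lemma UA_mulVec (hr : r < N) (θ : ℝ) (φ : Vertex N r → ℂ) :
    UA N r θ *ᵥ φ = φ - (1 - Complex.exp (θ * Complex.I)) • avgA N r φ := by
  funext v
  rw [UA, Matrix.sub_mulVec, Matrix.one_mulVec, Matrix.smul_mulVec, Matrix.sum_mulVec]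
  simp only [Pi.sub_apply, Pi.smul_apply, Finset.sum_apply]
  congr 2
  rw [Finset.sum_eq_single v.1.1]
  · have hs : ((Real.sqrt ((N : ℝ) - r) : ℝ) : ℂ) * (Real.sqrt ((N : ℝ) - r) : ℝ) = (N : ℂ) - r := by
      rw [← Complex.ofReal_mul, Real.mul_self_sqrt]
      · push_cast
        ring
      · rw [sub_nonneg]
        exact_mod_cast hr.le
    simp only [Matrix.vecMulVec_mulVec, avgA, LinearMap.coe_mk, AddHom.coe_mk, ketA, dotProduct,
      Pi.smul_apply, if_true, ← hs, mul_inv, Finset.mul_sum]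
    simp only [MulOpposite.smul_eq_mul_unop, MulOpposite.unop_op, Finset.mul_sum]
    refine Finset.sum_congr rfl fun w _ => ?_
    simp only [Pi.star_apply, ketA]
    split_ifs
    · simp
      ring
    · simp
  · intro S _ hS
    simp [Matrix.vecMulVec_mulVec, ketA, Ne.symm hS]
  · intro h
    exact absurd (Finset.mem_powersetCard.2 ⟨Finset.subset_univ _, v.2.1⟩) h

lemma star_ketA_dotProduct (hr : r < N) {S T : Finset (Fin N)} (hS : S.card = r) :
    star (ketA (r := r) S) ⬝ᵥ ketA T = if S = T then 1 else 0 := by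
  have hs : ((Real.sqrt ((N : ℝ) - r) : ℝ) : ℂ) * (Real.sqrt ((N : ℝ) - r) : ℝ) = (N : ℂ) - r := by
    rw [← Complex.ofReal_mul, Real.mul_self_sqrt]
    · push_cast
      ring
    · rw [sub_nonneg]
      exact_mod_cast hr.le
  have h0 : (N : ℂ) - r ≠ 0 := by
    rw [sub_ne_zero]
    exact_mod_cast hr.ne'
  have h1 : star (ketA (r := r) S) ⬝ᵥ ketA T =
      ∑ w : Vertex N r, if w.1.1 = S then (if S = T then ((N : ℂ) - r)⁻¹ else 0) else 0 := by
    refine Finset.sum_congr rfl fun w _ => ?_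
    simp only [Pi.star_apply, ketA]
    by_cases h : w.1.1 = S
    · by_cases h' : S = T
      · simp [h, h', ← hs]
      · simp [h, h']
    · simp [h]
  rw [h1, sum_vertex_same_set hS fun _ _ => if S = T then ((N : ℂ) - r)⁻¹ else 0]
  rw [Finset.sum_const, Finset.card_compl, hS, Fintype.card_fin, nsmul_eq_mul, Nat.cast_sub hr.le]
  split_ifs
  · exact mul_inv_cancel₀ h0
  · simp

lemma UA_mem_unitaryGroup (hr : r < N) (θ : ℝ) :
    UA N r θ ∈ Matrix.unitaryGroup (Vertex N r) ℂ :=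
  one_sub_smul_sum_vecMulVec_mem_unitaryGroup _ _ (fun _ hS _ _ =>
    star_ketA_dotProduct hr (Finset.mem_powersetCard.1 hS).2) θ

/-- Every `g` on K is the restriction of some string, and for such `g` the condition on the slots
says that they are filled from this string. Overlaps can thus be computed without sorting the
elements of K. -/
lemma ketB_comp_orderEmbOfFin (K : {K : Finset (Fin N) // K.card = r + 1}) (x : Fin N → Fin M) :
    ketB M m K (fun k => x (K.1.orderEmbOfFin K.2 k)) = fun z =>
      if insert z.1.1.2 z.1.1.1 = K.1 ∧ z.2 = fullSlots m x z.1
      then 1 / (Real.sqrt ((r : ℝ) + 1) : ℂ) else 0 := by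
  funext ⟨v, s⟩
  simp only [ketB]
  congr 1
  rw [eq_iff_iff]
  refine and_congr_right fun hK => ?_
  constructor
  · intro h
    funext j
    have hj : slotIndex v j ∈ Set.range (K.1.orderEmbOfFin K.2) := by
      rw [Finset.range_orderEmbOfFin, ← hK]
      exact slotIndex_mem_insert v j
    obtain ⟨k, hk⟩ := hj
    rw [h j k hk.symm, hk, fullSlots]
  · rintro rfl j k hk
    rw [fullSlots, hk]

lemma exists_comp_orderEmbOfFin_eq (K : {K : Finset (Fin N) // K.card = r + 1})
    (g : Fin (r + 1) → Fin M) :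
    ∃ x : Fin N → Fin M, g = fun k => x (K.1.orderEmbOfFin K.2 k) := by
  refine ⟨Function.extend (K.1.orderEmbOfFin K.2) g fun _ => g 0, ?_⟩
  funext k
  rw [(K.1.orderEmbOfFin K.2).injective.extend_apply]

lemma fullSlots_eq_iff (hM : M ≤ 2 ^ m) (x x' : Fin N → Fin M) (v : Vertex N r) :
    fullSlots m x v = fullSlots m x' v ↔ ∀ i ∈ insert v.1.2 v.1.1, x i = x' i := by
  constructor
  · intro h i hi
    obtain ⟨j, rfl⟩ := exists_slotIndex_eq v hi
    exact encode_injective hM (congrFun h j)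
  · intro h
    funext j
    rw [fullSlots, fullSlots, h _ (slotIndex_mem_insert v j)]

lemma comp_orderEmbOfFin_eq_iff (K : {K : Finset (Fin N) // K.card = r + 1})
    (x x' : Fin N → Fin M) :
    ((fun k => x (K.1.orderEmbOfFin K.2 k)) = fun k => x' (K.1.orderEmbOfFin K.2 k)) ↔
      ∀ i ∈ K.1, x i = x' i := by
  constructor
  · intro h i hi
    have : i ∈ Set.range (K.1.orderEmbOfFin K.2) := by simpa using hi
    obtain ⟨k, rfl⟩ := this
    exact congrFun h k
  · intro h
    funext k
    exact h _ (by simp)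

lemma sqrt_mul_sqrt_succ (r : ℕ) :
    ((Real.sqrt ((r : ℝ) + 1) : ℝ) : ℂ) * (Real.sqrt ((r : ℝ) + 1) : ℝ) = (r : ℂ) + 1 := by
  rw [← Complex.ofReal_mul, Real.mul_self_sqrt (by positivity)]
  push_cast
  ring

/-- The overlap of `|B_K^g⟩` with a state whose slots hold the values of `x`. -/
lemma star_ketB_dotProduct_withSlots (hM : M ≤ 2 ^ m)
    (K : {K : Finset (Fin N) // K.card = r + 1}) (g : Fin (r + 1) → Fin M) (x : Fin N → Fin M)
    (φ : Vertex N r → ℂ) :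
    star (ketB M m K g) ⬝ᵥ withSlots (fullSlots m x) φ =
      if g = fun k => x (K.1.orderEmbOfFin K.2 k) then
        1 / (Real.sqrt ((r : ℝ) + 1) : ℂ) *
          ∑ w : Vertex N r, if insert w.1.2 w.1.1 = K.1 then φ w else 0
      else 0 := by
  obtain ⟨x', rfl⟩ := exists_comp_orderEmbOfFin_eq K g
  rw [ketB_comp_orderEmbOfFin, dotProduct, Fintype.sum_prod_type]
  simp only [comp_orderEmbOfFin_eq_iff]
  have key : ∀ v : Vertex N r, (∑ s, star (fun z : WalkBasis N r m =>
      if insert z.1.1.2 z.1.1.1 = K.1 ∧ z.2 = fullSlots m x' z.1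
      then 1 / (Real.sqrt ((r : ℝ) + 1) : ℂ) else 0) (v, s) *
        withSlots (fullSlots m x) φ (v, s)) =
      if ∀ i ∈ K.1, x' i = x i then
        1 / (Real.sqrt ((r : ℝ) + 1) : ℂ) * (if insert v.1.2 v.1.1 = K.1 then φ v else 0)
      else 0 := by
    intro v
    rw [Finset.sum_eq_single (fullSlots m x v)]
    · by_cases hK : insert v.1.2 v.1.1 = K.1
      · have hiff : fullSlots m x v = fullSlots m x' v ↔ ∀ i ∈ K.1, x' i = x i := by
          rw [eq_comm, fullSlots_eq_iff hM, hK]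
        simp only [Pi.star_apply, hK, true_and, withSlots, if_true, hiff]
        split_ifs <;> simp
      · simp [hK]
    · intro s _ hs
      simp [withSlots, hs]
    · simp
  rw [Finset.sum_congr rfl fun v _ => key v, Finset.mul_sum]
  split_ifs <;> simp

lemma UBext_mulVec (hM : M ≤ 2 ^ m) (θ : ℝ) (x : Fin N → Fin M) (φ : Vertex N r → ℂ) :
    UBext N r M m θ *ᵥ withSlots (fullSlots m x) φ = withSlots (fullSlots m x)
      (φ - (1 - Complex.exp (θ * Complex.I)) • avgB N r φ) := by
  have hsum : (∑ K : {K : Finset (Fin N) // K.card = r + 1}, ∑ g : Fin (r + 1) → Fin M,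
      Matrix.vecMulVec (ketB M m K g) (star (ketB M m K g))) *ᵥ withSlots (fullSlots m x) φ =
      withSlots (fullSlots m x) (avgB N r φ) := by
    simp only [Matrix.sum_mulVec, Matrix.vecMulVec_mulVec, star_ketB_dotProduct_withSlots hM]
    funext ⟨v, s⟩
    simp only [Finset.sum_apply]
    rw [Finset.sum_eq_single ⟨_, card_insert_vertex v⟩]
    · rw [Finset.sum_eq_single fun k =>
        x ((insert v.1.2 v.1.1).orderEmbOfFin (card_insert_vertex v) k)]
      · rw [if_pos rfl]
        have h := ketB_comp_orderEmbOfFin (m := m) ⟨_, card_insert_vertex v⟩ x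
        simp only at h
        rw [h]
        simp only [Pi.smul_apply, true_and, withSlots, MulOpposite.smul_eq_mul_unop,
          MulOpposite.unop_op, avgB, LinearMap.coe_mk, AddHom.coe_mk, ← sqrt_mul_sqrt_succ, mul_inv]
        split_ifs
        · ring
        · simp
      · intro g _ hg
        rw [if_neg hg]
        simp
      · simp
    · intro K _ hK
      refine Finset.sum_eq_zero fun g _ => ?_
      have : insert v.1.2 v.1.1 ≠ K.1 := fun h => hK (Subtype.ext h.symm)
      simp [ketB, this]
    · simp
  rw [UBext, Matrix.sub_mulVec, Matrix.one_mulVec, Matrix.smul_mulVec, hsum]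
  funext z
  simp only [withSlots, Pi.sub_apply, Pi.smul_apply]
  split_ifs <;> simp

/-- The second vector is itself a state with slots filled from a string, so the previous overlap
formula applies. -/
lemma star_ketB_dotProduct (hM : M ≤ 2 ^ m) (K K' : {K : Finset (Fin N) // K.card = r + 1})
    (g g' : Fin (r + 1) → Fin M) :
    star (ketB M m K g) ⬝ᵥ ketB M m K' g' = if (K, g) = (K', g') then 1 else 0 := by
  obtain ⟨x, rfl⟩ := exists_comp_orderEmbOfFin_eq K' g'
  have h1 : ketB M m K' (fun k => x (K'.1.orderEmbOfFin K'.2 k)) = withSlots (fullSlots m x)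
      fun v => if insert v.1.2 v.1.1 = K'.1 then 1 / (Real.sqrt ((r : ℝ) + 1) : ℂ) else 0 := by
    rw [ketB_comp_orderEmbOfFin]
    funext z
    simp only [withSlots]
    by_cases h : insert z.1.1.2 z.1.1.1 = K'.1 <;> simp [h]
  rw [h1, star_ketB_dotProduct_withSlots hM]
  by_cases hK : K = K'
  · subst hK
    have h2 : (∑ w : Vertex N r, if insert w.1.2 w.1.1 = K.1 then
        1 / (Real.sqrt ((r : ℝ) + 1) : ℂ) else 0) =
        ((r : ℂ) + 1) * (1 / (Real.sqrt ((r : ℝ) + 1) : ℂ)) := by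
      have h3 := sum_vertex_same_insert K.2 fun _ _ => 1 / (Real.sqrt ((r : ℝ) + 1) : ℂ)
      rw [Finset.sum_const, K.2, nsmul_eq_mul] at h3
      push_cast at h3
      exact h3
    have h0 : ((Real.sqrt ((r : ℝ) + 1) : ℝ) : ℂ) ≠ 0 := by
      rw [Complex.ofReal_ne_zero]
      positivity
    simp only [Prod.mk.injEq, true_and]
    split_ifs
    · rw [h2, ← sqrt_mul_sqrt_succ]
      field_simp
    · rfl
  · rw [if_neg (fun h => hK (Prod.ext_iff.1 h).1)]
    split_ifs
    · rw [Finset.sum_eq_zero, mul_zero]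
      intro w _
      split_ifs with h h'
      · exact absurd (Subtype.ext (h.symm.trans h')) hK
      · rfl
      · rfl
    · rfl

lemma UBext_mem_unitaryGroup (hM : M ≤ 2 ^ m) (θ : ℝ) :
    UBext N r M m θ ∈ Matrix.unitaryGroup (WalkBasis N r m) ℂ := by
  have h := one_sub_smul_sum_vecMulVec_mem_unitaryGroup
    (Finset.univ : Finset ({K : Finset (Fin N) // K.card = r + 1} × (Fin (r + 1) → Fin M)))
    (fun i => ketB M m i.1 i.2) (fun i _ j _ => star_ketB_dotProduct hM i.1 j.1 i.2 j.2) θ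
  rwa [Fintype.sum_prod_type] at h

lemma UA_kronecker_mulVec (hr : r < N) (θ : ℝ) (x : Fin N → Fin M) (φ : Vertex N r → ℂ) :
    (UA N r θ ⊗ₖ (1 : Matrix (Fin (r + 1) → Bits m) (Fin (r + 1) → Bits m) ℂ)) *ᵥ
      withSlots (setSlots m x) φ = withSlots (setSlots m x)
        (φ - (1 - Complex.exp (θ * Complex.I)) • avgA N r φ) := by
  funext ⟨v, s⟩
  have h1 : ((UA N r θ ⊗ₖ (1 : Matrix (Fin (r + 1) → Bits m) (Fin (r + 1) → Bits m) ℂ)) *ᵥ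
      withSlots (setSlots m x) φ) (v, s) =
      (UA N r θ *ᵥ fun w => withSlots (setSlots m x) φ (w, s)) v := by
    simp only [Matrix.mulVec, dotProduct, Fintype.sum_prod_type, Matrix.kroneckerMap_apply,
      Matrix.one_apply]
    refine Finset.sum_congr rfl fun w _ => ?_
    rw [Finset.sum_eq_single s (by intro c _ hc; simp [Ne.symm hc]) (by simp)]
    simp
  rw [h1, UA_mulVec hr]
  simp only [Pi.sub_apply, Pi.smul_apply, withSlots, avgA, LinearMap.coe_mk, AddHom.coe_mk]
  by_cases hs : s = setSlots m x v
  · simp only [hs, if_true]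
    congr 3
    refine Finset.sum_congr rfl fun w _ => ?_
    split_ifs with h h'
    · rfl
    · exact absurd (setSlots_congr x h.symm) h'
    · rfl
  · simp only [hs, if_false, zero_sub, neg_eq_zero, smul_eq_zero, mul_eq_zero]
    right
    right
    refine Finset.sum_eq_zero fun w _ => ?_
    split_ifs with h h'
    · exact absurd (h'.trans (setSlots_congr x h)) hs
    · rfl
    · rfl

/-! ### The walk on the vertices -/

/-- The action of one step of the walk on amplitudes of vertices. -/
def vertexStep (N r : ℕ) (e₁ e₂ : ℂ) : (Vertex N r → ℂ) →ₗ[ℂ] (Vertex N r → ℂ) :=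
  (LinearMap.id - (1 - e₂) • avgB N r) ∘ₗ (LinearMap.id - (1 - e₁) • avgA N r)

/-- U_A meets a blank last slot and U_B a full one. In both cases the contents agree on all vertices
being averaged, and the second query uncomputes the last slot. -/
lemma step_withSlots (hr : r < N) (hM : M ≤ 2 ^ m) (P : WalkParams) (x : Fin N → Fin M)
    (φ : Vertex N r → ℂ) :
    P.step x (withSlots (setSlots m x) φ) = withSlots (setSlots m x)
      (vertexStep N r (Complex.exp (P.θ₁ * Complex.I)) (Complex.exp (P.θ₂ * Complex.I)) φ) := by
  rw [WalkParams.step, UA_kronecker_mulVec hr, loadY_withSlots_setSlots, UBext_mulVec hM,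
    loadY_withSlots_fullSlots]
  rfl

/-- Two elements of the set of the vertex have equal values. -/
def HasCollision (x : Fin N → Fin M) (v : Vertex N r) : Prop :=
  ∃ a ∈ v.1.1, ∃ b ∈ v.1.1, a ≠ b ∧ x a = x b

lemma marked_setSlots_iff (hM : M ≤ 2 ^ m) (x : Fin N → Fin M) (v : Vertex N r) :
    Marked (v, setSlots m x v) ↔ HasCollision x v := by
  have hslot : ∀ j : Fin r, setSlots m x v j.castSucc = encode m (x (slotIndex v j.castSucc)) :=
    fun j => by simp [setSlots, (Fin.castSucc_lt_last j).ne]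
  constructor
  · rintro ⟨⟨j, k⟩, hjk, h⟩
    simp only [hslot] at h hjk
    refine ⟨_, slotIndex_castSucc_mem v j, _, slotIndex_castSucc_mem v k, ?_,
      encode_injective hM h⟩
    rw [slotIndex_castSucc, slotIndex_castSucc]
    exact fun h => hjk.ne ((v.1.1.orderEmbOfFin v.2.1).injective h)
  · rintro ⟨a, ha, b, hb, hab, h⟩
    obtain ⟨j, rfl⟩ := exists_slotIndex_castSucc_eq v ha
    obtain ⟨k, rfl⟩ := exists_slotIndex_castSucc_eq v hb
    have hjk : j ≠ k := fun h => hab (by rw [h])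
    rcases lt_or_gt_of_ne hjk with hlt | hlt
    · exact ⟨(j, k), hlt, by simp only [hslot, h]⟩
    · exact ⟨(k, j), hlt, by simp only [hslot, h]⟩

open Classical in
/-- The action of the marking operator on amplitudes of vertices. -/
def vertexMark (x : Fin N → Fin M) (e : ℂ) (φ : Vertex N r → ℂ) : Vertex N r → ℂ :=
  fun v => if HasCollision x v then e * φ v else φ v

lemma RT_withSlots (hM : M ≤ 2 ^ m) (α : ℝ) (x : Fin N → Fin M) (φ : Vertex N r → ℂ) :
    RT α (withSlots (setSlots m x) φ) =
      withSlots (setSlots m x) (vertexMark x (Complex.exp (α * Complex.I)) φ) := by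
  classical
  funext ⟨v, s⟩
  simp only [RT, withSlots, vertexMark]
  by_cases hs : s = setSlots m x v
  · subst hs
    simp [marked_setSlots_iff hM]
  · simp [hs]

/-- The action of one round of the walk on amplitudes of vertices. -/
def vertexRound (P : WalkParams) (x : Fin N → Fin M) (φ : Vertex N r → ℂ) : Vertex N r → ℂ :=
  let u := vertexStep N r (Complex.exp (P.θ₁ * Complex.I)) (Complex.exp (P.θ₂ * Complex.I))
  (u ^ P.inner) (vertexMark x (Complex.exp (P.α₂ * Complex.I))
    ((u ^ P.inner) (vertexMark x (Complex.exp (P.α₁ * Complex.I)) φ)))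

lemma final_eq_withSlots (hr : r < N) (hM : M ≤ 2 ^ m) (P : WalkParams) (x : Fin N → Fin M) :
    P.final r m x = withSlots (setSlots m x) ((vertexRound P x)^[P.outer]
      fun _ => 1 / (Real.sqrt (Fintype.card (Vertex N r)) : ℂ)) := by
  have hstep : ∀ (k : ℕ) (φ : Vertex N r → ℂ),
      (P.step x)^[k] (withSlots (setSlots m x) φ) = withSlots (setSlots m x)
        ((vertexStep N r (Complex.exp (P.θ₁ * Complex.I))
          (Complex.exp (P.θ₂ * Complex.I)) ^ k) φ) := by
    intro k φ
    induction k with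
    | zero => rfl
    | succ k ih =>
      rw [Function.iterate_succ_apply', ih, step_withSlots hr hM, pow_succ', Module.End.mul_apply]
  have hround : ∀ φ : Vertex N r → ℂ, P.round x (withSlots (setSlots m x) φ) =
      withSlots (setSlots m x) (vertexRound P x φ) := by
    intro φ
    rw [WalkParams.round, RT_withSlots hM, hstep, RT_withSlots hM, hstep]
    rfl
  rw [WalkParams.final, loadS_walkStart]
  generalize (fun _ : Vertex N r => 1 / (Real.sqrt (Fintype.card (Vertex N r)) : ℂ)) = φ
  induction P.outer with
  | zero => rfl
  | succ k ih => rw [Function.iterate_succ_apply', ih, hround, Function.iterate_succ_apply']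

/-! ### The walk as a query algorithm -/

lemma loadY_eq_loadSlot : loadY (N := N) (r := r) (M := M) (m := m) =
    loadSlot slotIndex (Fin.last r) := by
  funext x ψ z
  simp only [loadY, loadSlot]
  congr 2
  funext j
  by_cases hj : j = Fin.last r
  · subst hj
    simp
  · simp [hj]

lemma loadS_eq_loadBelow : loadS (N := N) (r := r) (M := M) (m := m) =
    loadBelow slotIndex r := by
  funext x ψ z
  simp only [loadS, loadBelow]
  congr 2
  funext j
  refine Fin.lastCases ?_ (fun j => ?_) j
  · simp
  · simp [(Fin.castSucc_lt_last j).ne]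

lemma exists_unitary_RT (α : ℝ) : ∃ U : Matrix.unitaryGroup (WalkBasis N r m) ℂ,
    RT α = fun ψ => (U : Matrix (WalkBasis N r m) (WalkBasis N r m) ℂ) *ᵥ ψ := by
  classical
  refine ⟨⟨Matrix.diagonal fun z => if Marked z then Complex.exp (α * Complex.I) else 1,
    diagonal_mem_unitaryGroup _ fun z => ?_⟩, ?_⟩
  · split_ifs
    · exact Complex.norm_exp_ofReal_mul_I α
    · simp
  · funext ψ z
    rw [Matrix.mulVec_diagonal, RT]
    split_ifs <;> simp

lemma queryProgram_step (hr : r < N) (hM : M ≤ 2 ^ m) (P : WalkParams) :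
    QueryProgram (V := Vertex N r) slotIndex 2 (P.step (M := M) (m := m)) := by
  have hA := QueryProgram.unitary (M := M) (idx := slotIndex (N := N) (r := r))
    ⟨UA N r P.θ₁ ⊗ₖ (1 : Matrix (Fin (r + 1) → Bits m) (Fin (r + 1) → Bits m) ℂ),
      Matrix.kronecker_mem_unitary (UA_mem_unitaryGroup hr P.θ₁) (one_mem _)⟩
  have hB := QueryProgram.query (Fin.last r) ⟨UBext N r M m P.θ₂, UBext_mem_unitaryGroup hM P.θ₂⟩ hA
  have h := (QueryProgram.loadSlot (Fin.last r)).comp hB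
  rwa [← loadY_eq_loadSlot] at h

lemma queryProgram_walk (hr : r < N) (hM : M ≤ 2 ^ m) (P : WalkParams) :
    QueryProgram (V := Vertex N r) slotIndex (P.queries r)
      fun (x : Fin N → Fin M) ψ => (P.round (m := m) x)^[P.outer] (loadS x ψ) := by
  obtain ⟨R₁, h₁⟩ := exists_unitary_RT (N := N) (r := r) (m := m) P.α₁
  obtain ⟨R₂, h₂⟩ := exists_unitary_RT (N := N) (r := r) (m := m) P.α₂
  have hs := (queryProgram_step (M := M) (m := m) hr hM P).iterate P.inner
  have hround := (hs.comp (QueryProgram.unitary (M := M) (idx := slotIndex) R₂)).comp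
    (hs.comp (QueryProgram.unitary (M := M) (idx := slotIndex) R₁))
  have hload := QueryProgram.loadBelow (M := M) (m := m) (idx := slotIndex (N := N) (r := r))
    (Nat.le_succ r)
  rw [← loadS_eq_loadBelow] at hload
  convert (hround.iterate P.outer).comp hload using 1
  · rw [WalkParams.queries]
    ring
  · funext x ψ
    congr 1
    funext ψ
    rw [WalkParams.round, h₁, h₂]

lemma sum_norm_sq_walkStart [Nonempty (Vertex N r)] : ∑ z, ‖walkStart N r m z‖ ^ 2 = 1 := by
  rw [Fintype.sum_prod_type]
  have h : ∀ v : Vertex N r, ∑ s, ‖walkStart N r m (v, s)‖ ^ 2 =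
      1 / (Fintype.card (Vertex N r) : ℝ) := by
    intro v
    rw [Finset.sum_eq_single fun _ _ => false]
    · simp [walkStart]
    · intro s _ hs
      simp [walkStart, hs]
    · simp
  rw [Finset.sum_congr rfl fun v _ => h v]
  simp

/-- Every walk is carried out by a query algorithm, whose answers are correct if those of the walk
are. -/
lemma exists_implements (hr : r < N) (hM : M ≤ 2 ^ m) (P : WalkParams) :
    ∃ A : QueryAlgorithm N m, A.queries = P.queries r ∧ A.Implements M r P ∧
      ∀ x : Fin N → Fin M, (∀ z, P.final r m x z ≠ 0 → IsCorrect x (walkOut z)) →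
        A.successProb x = 1 := by
  have : NeZero N := ⟨by omega⟩
  obtain ⟨S, -, hS⟩ := Finset.exists_subset_card_eq
    (s := (Finset.univ : Finset (Fin N))) (n := r) (by simpa using hr.le)
  obtain ⟨y, hy⟩ : ∃ y, y ∉ S := by
    by_contra! h
    have : S = Finset.univ := Finset.eq_univ_of_forall h
    rw [this, Finset.card_univ, Fintype.card_fin] at hS
    omega
  have : Nonempty (Vertex N r) := ⟨⟨(S, y), hS, hy⟩⟩
  let z₀ : WalkBasis N r m := (⟨(S, y), hS, hy⟩, fun _ _ => false)
  -- A query algorithm starts in a basis state; the uniform superposition is prepared by an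
  -- input-independent unitary at no query cost.
  obtain ⟨U₀, hU₀⟩ := exists_unitary_mulVec_single z₀ (walkStart N r m) sum_norm_sq_walkStart
  have hprog := (queryProgram_walk (m := m) hr hM P).comp
    (QueryProgram.unitary (M := M) (idx := slotIndex) U₀)
  rw [zero_add] at hprog
  let out : Fin N × Bits m × WalkBasis N r m → Option (Fin N × Fin N) := fun a => walkOut a.2.2
  obtain ⟨U, hU⟩ := hprog.exists_state_eq z₀ out
  let A : QueryAlgorithm N m :=
    QueryAlgorithm.mk (WalkBasis N r m) (P.queries r) U (0, (fun _ => false), z₀) out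
  have hfinal : ∀ x : Fin N → Fin M, A.final x = withBlankQuery (P.final r m x) := by
    intro x
    have h := hU x
    rw [hU₀] at h
    exact h
  refine ⟨A, rfl, ⟨rfl, fun z => (0, (fun _ => false), z), fun z w h => ?_, fun z => rfl,
    fun x => ⟨fun z => ?_, fun a ha => ?_⟩⟩, fun x hx => A.successProb_eq_one x fun a ha => ?_⟩
  · simpa using h
  · rw [hfinal]
    simp [withBlankQuery]
  · rw [hfinal, withBlankQuery, if_neg]
    rintro ⟨h1, h2⟩
    exact ha ⟨a.2.2, by rw [← h1, ← h2]⟩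
  · rw [hfinal, withBlankQuery] at ha
    split_ifs at ha with h
    · exact hx _ ha
    · exact absurd rfl ha

/-- The answer of the walk is correct on a basis state whose slots hold the values of `x`, if this
basis state is marked or `x` has no collision. -/
lemma isCorrect_walkOut (hM : M ≤ 2 ^ m) (x : Fin N → Fin M) (v : Vertex N r)
    (h : HasCollision x v ∨ Function.Injective x) :
    IsCorrect x (walkOut (v, setSlots m x v)) := by
  classical
  rw [walkOut]
  split_ifs with hz
  · have hslot : ∀ j : Fin r, setSlots m x v j.castSucc = encode m (x (slotIndex v j.castSucc)) :=
      fun j => by simp [setSlots, (Fin.castSucc_lt_last j).ne]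
    have hs := hz.choose_spec
    generalize hz.choose = p at hs ⊢
    simp only [hslot] at hs
    refine ⟨?_, encode_injective hM hs.2⟩
    rw [slotIndex_castSucc, slotIndex_castSucc]
    exact fun h => hs.1.ne ((v.1.1.orderEmbOfFin v.2.1).injective h)
  · rw [marked_setSlots_iff hM] at hz
    exact h.resolve_left hz

end Slots

/-! ### Products of two phase rotations -/

section Blocks

variable {E : Type*} [AddCommGroup E] [Module ℂ E]

/-- A product of phase rotations on the ranges of two projections satisfies a quadratic equation at
a vector `a` that the first projection fixes and the product of the projections scales. -/
lemma rotation_comp_rotation_quadratic (A B : E →ₗ[ℂ] E) {a : E} {μ e₁ e₂ : ℂ} (hA : A a = a)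
    (hB : B (B a) = B a) (hAB : A (B a) = μ • a) (u : E →ₗ[ℂ] E)
    (hu : u = (LinearMap.id - (1 - e₂) • B) ∘ₗ (LinearMap.id - (1 - e₁) • A)) :
    u (u a) = (e₁ + e₂ + (1 - e₁) * (1 - e₂) * μ) • u a - (e₁ * e₂) • a := by
  subst hu
  simp only [LinearMap.comp_apply, LinearMap.sub_apply, LinearMap.id_apply, LinearMap.smul_apply,
    map_sub, map_smul, hA, hB, hAB, smul_sub]
  module

/-- If two distinct roots `l₁`, `l₂` of the quadratic equation of `u` at `a` have the same `t`-th
power, then `u ^ t` scales `a` by it. -/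
lemma pow_apply_eq_smul_of_quadratic (u : E →ₗ[ℂ] E) {a : E} {l₁ l₂ c : ℂ} {t : ℕ}
    (h : u (u a) = (l₁ + l₂) • u a - (l₁ * l₂) • a) (hne : l₁ ≠ l₂) (h₁ : l₁ ^ t = c)
    (h₂ : l₂ ^ t = c) : (u ^ t) a = c • a := by
  -- The closed form of the two-term recurrence, multiplied by l₁ - l₂ to avoid a division.
  have key : ∀ n : ℕ, (l₁ - l₂) • (u ^ n) a =
      l₁ ^ n • (u a - l₂ • a) - l₂ ^ n • (u a - l₁ • a) := by
    intro n
    induction n with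
    | zero =>
      simp only [pow_zero, Module.End.one_apply, one_smul]
      module
    | succ n ih =>
      rw [pow_succ', Module.End.mul_apply, ← map_smul, ih]
      simp only [map_sub, map_smul, h]
      module
  have h3 := key t
  rw [h₁, h₂] at h3
  have h4 : (l₁ - l₂) • (u ^ t) a = (l₁ - l₂) • (c • a) := by
    rw [h3]
    module
  exact smul_right_injective E (sub_ne_zero.2 hne) h4

end Blocks

/-! ### The invariant subspace of a colliding pair -/

section Collision

variable {N r : ℕ}

/-- A mean over the vertices with the same S ∪ {y} is a function of S ∪ {y} only. -/
lemma avgB_avgB (φ : Vertex N r → ℂ) : avgB N r (avgB N r φ) = avgB N r φ :=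
  avgB_eq_self fun K => ((r : ℂ) + 1)⁻¹ *
    ∑ w : Vertex N r, if insert w.1.2 w.1.1 = K then φ w else 0

/-- The indicator of the vertices whose set contains `i`. -/
def memIndicator (N r : ℕ) (i : Fin N) : Vertex N r → ℂ := fun v => if i ∈ v.1.1 then 1 else 0

/-- The indicator of the vertices whose set contains `i` and `j`. -/
def pairIndicator (N r : ℕ) (i j : Fin N) : Vertex N r → ℂ :=
  fun v => if i ∈ v.1.1 ∧ j ∈ v.1.1 then 1 else 0

/-- Of the r + 1 vertices over K ∋ i, only the one with y = i has i outside S. -/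
lemma avgB_memIndicator (i : Fin N) :
    avgB N r (memIndicator N r i) = fun v =>
      (r / (r + 1) : ℂ) * if i ∈ insert v.1.2 v.1.1 then 1 else 0 := by
  funext v
  have h := avgB_apply (fun S _ => if i ∈ S then (1 : ℂ) else 0) v
  refine h.trans ?_
  have hc := card_insert_vertex v
  generalize insert v.1.2 v.1.1 = K at hc
  have h2 : ∀ y ∈ K, (if i ∈ K.erase y then (1 : ℂ) else 0) =
      (if i ∈ K then 1 else 0) - if i = y then 1 else 0 := by
    intro y hy
    by_cases hiy : i = y
    · subst hiy
      simp [hy]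
    · simp [hiy]
  rw [Finset.sum_congr rfl h2, Finset.sum_sub_distrib, Finset.sum_const, hc,
    Finset.sum_ite_eq]
  have h0 : (r : ℂ) + 1 ≠ 0 := by exact_mod_cast Nat.succ_ne_zero r
  split_ifs
  · simp
    field_simp
  · simp

/-- Of the r + 1 vertices over K ⊇ {i, j}, exactly the two with y = i or y = j fail. -/
lemma avgB_pairIndicator {i j : Fin N} (hij : i ≠ j) :
    avgB N r (pairIndicator N r i j) = fun v =>
      ((r - 1) / (r + 1) : ℂ) *
        if i ∈ insert v.1.2 v.1.1 ∧ j ∈ insert v.1.2 v.1.1 then 1 else 0 := by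
  funext v
  have h := avgB_apply (fun S _ => if i ∈ S ∧ j ∈ S then (1 : ℂ) else 0) v
  refine h.trans ?_
  have hc := card_insert_vertex v
  generalize insert v.1.2 v.1.1 = K at hc
  have h0 : (r : ℂ) + 1 ≠ 0 := by exact_mod_cast Nat.succ_ne_zero r
  by_cases hK : i ∈ K ∧ j ∈ K
  · have h2 : ∀ y ∈ K, (if i ∈ K.erase y ∧ j ∈ K.erase y then (1 : ℂ) else 0) =
        1 - (if i = y then 1 else 0) - if j = y then 1 else 0 := by
      intro y hy
      by_cases hiy : i = y
      · subst hiy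
        simp [hij.symm]
      · by_cases hjy : j = y
        · subst hjy
          simp [hij]
        · simp [hiy, hjy, hK]
    rw [Finset.sum_congr rfl h2, Finset.sum_sub_distrib, Finset.sum_sub_distrib,
      Finset.sum_const, hc, Finset.sum_ite_eq, Finset.sum_ite_eq]
    simp [hK]
    field_simp
  · have h2 : ∀ y ∈ K, (if i ∈ K.erase y ∧ j ∈ K.erase y then (1 : ℂ) else 0) = 0 := by
      intro y hy
      rw [if_neg]
      exact fun h => hK ⟨Finset.mem_of_mem_erase h.1, Finset.mem_of_mem_erase h.2⟩
    rw [Finset.sum_congr rfl h2]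
    simp [hK]

lemma avgA_mem_insert (hr : r < N) (i : Fin N) :
    avgA N r (fun v => if i ∈ insert v.1.2 v.1.1 then 1 else 0) = fun v =>
      memIndicator N r i v + (1 - memIndicator N r i v) / ((N : ℂ) - r) := by
  funext v
  have h := avgA_apply (fun S y => if i ∈ insert y S then (1 : ℂ) else 0) v
  refine h.trans ?_
  have hc : (v.1.1ᶜ).card = N - r := by rw [Finset.card_compl, v.2.1, Fintype.card_fin]
  have h0 : (N : ℂ) - r ≠ 0 := by
    rw [sub_ne_zero]
    exact_mod_cast hr.ne'
  simp only [memIndicator]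
  by_cases hi : i ∈ v.1.1
  · simp [hi, hc, Nat.cast_sub hr.le, h0]
  · simp [hi]

/-- If S contains exactly one of i and j, a single y out of N - r completes the pair; if it contains
neither, no y does. -/
lemma avgA_pair_mem_insert (hr : r < N) {i j : Fin N} (hij : i ≠ j) :
    avgA N r (fun v => if i ∈ insert v.1.2 v.1.1 ∧ j ∈ insert v.1.2 v.1.1 then 1 else 0) =
      fun v => pairIndicator N r i j v +
        (memIndicator N r i v + memIndicator N r j v - 2 * pairIndicator N r i j v) /
          ((N : ℂ) - r) := by
  funext v
  have h := avgA_apply (fun S y => if i ∈ insert y S ∧ j ∈ insert y S then (1 : ℂ) else 0) v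
  refine h.trans ?_
  have hc : (v.1.1ᶜ).card = N - r := by rw [Finset.card_compl, v.2.1, Fintype.card_fin]
  have h0 : (N : ℂ) - r ≠ 0 := by
    rw [sub_ne_zero]
    exact_mod_cast hr.ne'
  simp only [memIndicator, pairIndicator]
  by_cases hi : i ∈ v.1.1
  · by_cases hj : j ∈ v.1.1
    · simp [hi, hj, hc, Nat.cast_sub hr.le, h0]
      norm_num
    · simp [hi, hj]
  · by_cases hj : j ∈ v.1.1
    · simp [hi, hj]
    · have h2 : ∀ y ∈ v.1.1ᶜ, (if i ∈ insert y v.1.1 ∧ j ∈ insert y v.1.1 then (1 : ℂ) else 0) =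
          0 := by
        intro y _
        rw [if_neg]
        simp only [Finset.mem_insert, hi, hj, or_false]
        rintro ⟨rfl, rfl⟩
        exact hij rfl
      rw [Finset.sum_congr rfl h2]
      simp [hi, hj]

/-- The proportion of the vertices whose set contains a given pair. -/
def markedFraction (N r : ℕ) : ℝ := r * (r - 1) / (N * (N - 1))

/-- The `k`-th eigenvalue `1 - k (N + 1 - k) / ((r + 1) (N - r))` of the product of the averaging
projections. -/
def walkEigenvalue (N r k : ℕ) : ℝ := 1 - k * (N + 1 - k) / ((r + 1) * (N - r))

/-- Both projections fix the constants, so each rotation contributes its full phase. -/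
lemma vertexStep_pow_one (hr : r < N) (e₁ e₂ : ℂ) (t : ℕ) :
    (vertexStep N r e₁ e₂ ^ t) (fun _ => 1) = fun _ => (e₁ * e₂) ^ t := by
  have hA := avgA_eq_self hr (fun _ => (1 : ℂ))
  have hB := avgB_eq_self (r := r) (N := N) (fun _ => (1 : ℂ))
  have h1 : vertexStep N r e₁ e₂ (fun _ => 1) = (e₁ * e₂) • fun _ => 1 := by
    simp only [vertexStep, LinearMap.comp_apply, LinearMap.sub_apply, LinearMap.id_apply,
      LinearMap.smul_apply, map_sub, map_smul, hA, hB]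
    module
  have h2 : ∀ t : ℕ, (vertexStep N r e₁ e₂ ^ t) (fun _ => 1) = (e₁ * e₂) ^ t • fun _ => 1 := by
    intro t
    induction t with
    | zero => simp
    | succ t ih =>
      rw [pow_succ', Module.End.mul_apply, ih, map_smul, h1, smul_smul, pow_succ]
  rw [h2]
  funext v
  simp

/-- If the `t`-th powers of the eigenvalues of the walk on the two nontrivial blocks coincide, then
`t` steps act on the span of the constants and the marked states as a phase rotation about the
constants. -/
lemma vertexStep_pow_pairIndicator (hr : r < N) (hN : 3 ≤ N) {i j : Fin N} (hij : i ≠ j)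
    {e₁ e₂ c : ℂ} {t : ℕ} {l l' : ℕ → ℂ} (hl : ∀ k, k = 1 ∨ k = 2 → l k ≠ l' k ∧
      l k * l' k = e₁ * e₂ ∧
      l k + l' k = e₁ + e₂ + (1 - e₁) * (1 - e₂) * walkEigenvalue N r k ∧
      l k ^ t = c ∧ l' k ^ t = c) :
    (vertexStep N r e₁ e₂ ^ t) (pairIndicator N r i j) =
      fun v => c * pairIndicator N r i j v + ((e₁ * e₂) ^ t - c) * markedFraction N r := by
  have h0 : (N : ℂ) - r ≠ 0 := by
    rw [sub_ne_zero]
    exact_mod_cast hr.ne'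
  have h1 : (r : ℂ) + 1 ≠ 0 := by exact_mod_cast Nat.succ_ne_zero r
  have h2 : (N : ℂ) ≠ 0 := by exact_mod_cast (by omega : N ≠ 0)
  have h3 : (N : ℂ) - 1 ≠ 0 := by
    rw [sub_ne_zero]
    exact_mod_cast (by omega : N ≠ 1)
  have h4 : (N : ℂ) - 2 ≠ 0 := by
    rw [sub_ne_zero]
    exact_mod_cast (by omega : N ≠ 2)
  set one : Vertex N r → ℂ := fun _ => 1 with hone
  -- The product AB is triangular on the constants, the single memberships and the pair indicator.
  -- `a₁` and `a₂` are its nonconstant eigenvectors; 2r/N and the marked fraction are the means that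
  -- have to be removed.
  set a₁ : Vertex N r → ℂ :=
    memIndicator N r i + memIndicator N r j - (2 * r / N : ℂ) • one with ha₁
  set a₂ : Vertex N r → ℂ := pairIndicator N r i j - ((r - 1) / (N - 2) : ℂ) • a₁ -
    (markedFraction N r : ℂ) • one with ha₂
  have hBone : avgB N r one = one := avgB_eq_self fun _ => (1 : ℂ)
  have hAone : avgA N r one = one := avgA_eq_self hr fun _ => (1 : ℂ)
  have hABm : ∀ i : Fin N, avgA N r (avgB N r (memIndicator N r i)) =
      (r / (r + 1) : ℂ) • (memIndicator N r i +
        ((N : ℂ) - r)⁻¹ • (one - memIndicator N r i)) := by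
    intro i
    have h := avgB_memIndicator (N := N) (r := r) i
    rw [h]
    have h' : (fun v : Vertex N r => (r / (r + 1) : ℂ) *
        if i ∈ insert v.1.2 v.1.1 then 1 else 0) = (r / (r + 1) : ℂ) •
          fun v : Vertex N r => if i ∈ insert v.1.2 v.1.1 then 1 else 0 := rfl
    rw [h', map_smul, avgA_mem_insert hr]
    congr 1
    funext v
    simp only [Pi.add_apply, Pi.smul_apply, Pi.sub_apply, hone, smul_eq_mul]
    ring
  have hABp : avgA N r (avgB N r (pairIndicator N r i j)) =
      ((r - 1) / (r + 1) : ℂ) • (pairIndicator N r i j + ((N : ℂ) - r)⁻¹ •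
        (memIndicator N r i + memIndicator N r j - (2 : ℂ) • pairIndicator N r i j)) := by
    have h := avgB_pairIndicator (N := N) (r := r) hij
    rw [h]
    have h' : (fun v : Vertex N r => ((r - 1) / (r + 1) : ℂ) *
        if i ∈ insert v.1.2 v.1.1 ∧ j ∈ insert v.1.2 v.1.1 then 1 else 0) =
        ((r - 1) / (r + 1) : ℂ) •
          fun v : Vertex N r => if i ∈ insert v.1.2 v.1.1 ∧ j ∈ insert v.1.2 v.1.1 then 1 else 0 :=
      rfl
    rw [h', map_smul, avgA_pair_mem_insert hr hij]
    congr 1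
    funext v
    simp only [Pi.add_apply, Pi.smul_apply, Pi.sub_apply, smul_eq_mul]
    ring
  have hAm : ∀ i : Fin N, avgA N r (memIndicator N r i) = memIndicator N r i := fun i =>
    avgA_eq_self hr fun S => if i ∈ S then 1 else 0
  have hAp : avgA N r (pairIndicator N r i j) = pairIndicator N r i j :=
    avgA_eq_self hr fun S => if i ∈ S ∧ j ∈ S then 1 else 0
  have hA₁ : avgA N r a₁ = a₁ := by
    simp only [ha₁, map_add, map_sub, map_smul, hAm, hAone]
  have hA₂ : avgA N r a₂ = a₂ := by
    simp only [ha₂, map_sub, map_smul, hAp, hA₁, hAone]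
  have hAB₁ : avgA N r (avgB N r a₁) = (walkEigenvalue N r 1 : ℂ) • a₁ := by
    simp only [ha₁, map_add, map_sub, map_smul, hABm, hAone, hBone]
    funext v
    simp only [Pi.add_apply, Pi.smul_apply, Pi.sub_apply, smul_eq_mul, hone, walkEigenvalue]
    push_cast
    field_simp
    ring
  have hAB₂ : avgA N r (avgB N r a₂) = (walkEigenvalue N r 2 : ℂ) • a₂ := by
    simp only [ha₂, map_sub, map_smul, hABp, hAB₁, hAone, hBone]
    funext v
    simp only [Pi.add_apply, Pi.smul_apply, Pi.sub_apply, smul_eq_mul, hone, walkEigenvalue,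
      markedFraction, ha₁]
    push_cast
    field_simp
    ring
  have hpow : ∀ k, (k = 1 ∨ k = 2) → ∀ a : Vertex N r → ℂ, avgA N r a = a →
      avgA N r (avgB N r a) = (walkEigenvalue N r k : ℂ) • a →
      (vertexStep N r e₁ e₂ ^ t) a = c • a := by
    intro k hk a ha hab
    obtain ⟨hne, hp, hs, hc, hc'⟩ := hl k hk
    refine pow_apply_eq_smul_of_quadratic _ ?_ hne hc hc'
    rw [hp, hs]
    exact rotation_comp_rotation_quadratic (avgA N r) (avgB N r) ha (avgB_avgB a) hab _ rfl
  have hT : pairIndicator N r i j =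
      a₂ + ((r - 1) / (N - 2) : ℂ) • a₁ + (markedFraction N r : ℂ) • one := by
    rw [ha₂]
    abel
  have hone_pow := vertexStep_pow_one hr e₁ e₂ t
  rw [← hone] at hone_pow
  rw [hT, map_add, map_add, map_smul, map_smul, hpow 1 (Or.inl rfl) a₁ hA₁ hAB₁,
    hpow 2 (Or.inr rfl) a₂ hA₂ hAB₂, hone_pow]
  funext v
  simp only [Pi.add_apply, Pi.smul_apply, smul_eq_mul, hone]
  ring

end Collision

/-! ### Rounds in the plane spanned by the constants and the marked states -/

/-- The solution of `w (n + 2) = 2 q w (n + 1) - w n` with `w 0 = 1` and `w 1 = w₁`. -/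
def chebyshevSeq (q w₁ : ℝ) : ℕ → ℝ
  | 0 => 1
  | 1 => w₁
  | n + 2 => 2 * q * chebyshevSeq q w₁ (n + 1) - chebyshevSeq q w₁ n

lemma continuous_chebyshevSeq {X : Type*} [TopologicalSpace X] {q w : X → ℝ} (hq : Continuous q)
    (hw : Continuous w) (n : ℕ) : Continuous fun a => chebyshevSeq (q a) (w a) n := by
  suffices h : (Continuous fun a => chebyshevSeq (q a) (w a) n) ∧
      Continuous fun a => chebyshevSeq (q a) (w a) (n + 1) from h.1
  induction n with
  | zero => exact ⟨continuous_const, hw⟩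
  | succ n ih =>
    refine ⟨ih.2, ?_⟩
    simp only [chebyshevSeq]
    exact ((continuous_const.mul hq).mul ih.2).sub ih.1

/-- Both sides satisfy the recurrence with coefficient 2 cos g and have the same first two terms. -/
lemma chebyshevSeq_cos_mul_sin (g w : ℝ) (n : ℕ) :
    chebyshevSeq (Real.cos g) w n * Real.sin g =
      Real.cos (n * g) * Real.sin g + Real.sin (n * g) * (w - Real.cos g) := by
  suffices h : ∀ n : ℕ, chebyshevSeq (Real.cos g) w n * Real.sin g =
      Real.cos (n * g) * Real.sin g + Real.sin (n * g) * (w - Real.cos g) ∧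
      chebyshevSeq (Real.cos g) w (n + 1) * Real.sin g =
      Real.cos (n * g + g) * Real.sin g + Real.sin (n * g + g) * (w - Real.cos g) from (h n).1
  intro n
  induction n with
  | zero =>
    simp [chebyshevSeq]
    ring
  | succ n ih =>
    have h1 : ((n + 1 : ℕ) : ℝ) * g = n * g + g := by push_cast; ring
    rw [h1]
    refine ⟨ih.2, ?_⟩
    have h2 : chebyshevSeq (Real.cos g) w (n + 1 + 1) * Real.sin g =
        2 * Real.cos g * (chebyshevSeq (Real.cos g) w (n + 1) * Real.sin g) -
          chebyshevSeq (Real.cos g) w n * Real.sin g := by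
      simp only [chebyshevSeq]
      ring
    rw [h2, ih.1, ih.2]
    have hc : Real.cos (n * g + g + g) = 2 * Real.cos g * Real.cos (n * g + g) -
        Real.cos (n * g) := by
      rw [Real.cos_add (n * g + g), Real.cos_add, Real.sin_add]
      linear_combination (-Real.cos (n * g)) * Real.sin_sq_add_cos_sq g
    have hs : Real.sin (n * g + g + g) = 2 * Real.cos g * Real.sin (n * g + g) -
        Real.sin (n * g) := by
      rw [Real.sin_add (n * g + g), Real.cos_add, Real.sin_add]
      linear_combination (-Real.sin (n * g)) * Real.sin_sq_add_cos_sq g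
    rw [hc, hs]
    ring

lemma chebyshevSeq_cos_cos (g : ℝ) (n : ℕ) :
    chebyshevSeq (Real.cos g) (Real.cos g) n = Real.cos (n * g) := by
  suffices h : ∀ n : ℕ, chebyshevSeq (Real.cos g) (Real.cos g) n = Real.cos (n * g) ∧
      chebyshevSeq (Real.cos g) (Real.cos g) (n + 1) = Real.cos (n * g + g) from (h n).1
  intro n
  induction n with
  | zero => simp [chebyshevSeq]
  | succ n ih =>
    have h1 : ((n + 1 : ℕ) : ℝ) * g = n * g + g := by push_cast; ring
    rw [h1]
    refine ⟨ih.2, ?_⟩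
    simp only [chebyshevSeq]
    rw [ih.1, ih.2, Real.cos_add (n * g + g), Real.cos_add, Real.sin_add]
    linear_combination Real.cos (n * g) * Real.sin_sq_add_cos_sq g

/-- The first coordinate of the iterates of a `2 × 2` matrix. -/
lemma iterate_fst_eq_chebyshevSeq {A B C D d : ℂ} {q w : ℝ} (hA : A = d * w)
    (htr : A + D = d * (2 * q)) (hdet : A * D - B * C = d ^ 2) (f : ℂ × ℂ → ℂ × ℂ)
    (hf : ∀ c, f c = (A * c.1 + B * c.2, C * c.1 + D * c.2)) (c : ℂ) (n : ℕ) :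
    (f^[n] (c, 0)).1 = c * d ^ n * chebyshevSeq q w n := by
  suffices h : ∀ n : ℕ, (f^[n] (c, 0)).1 = c * d ^ n * chebyshevSeq q w n ∧
      (f^[n + 1] (c, 0)).1 = c * d ^ (n + 1) * chebyshevSeq q w (n + 1) from (h n).1
  intro n
  induction n with
  | zero =>
    simp [chebyshevSeq, hf, hA]
    ring
  | succ n ih =>
    refine ⟨ih.2, ?_⟩
    obtain ⟨h0, h1⟩ := ih
    rw [Function.iterate_succ_apply'] at h1
    rw [Function.iterate_succ_apply', Function.iterate_succ_apply']
    simp only [chebyshevSeq]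
    generalize f^[n] (c, 0) = y at h0 h1
    rw [hf] at h1
    rw [hf, hf]
    simp only at h1 ⊢
    push_cast
    -- Cayley–Hamilton: the square of the matrix is its trace times itself minus its determinant.
    linear_combination (A + D) * h1 - (A * D - B * C) * h0 +
      c * d ^ (n + 1) * (chebyshevSeq q w (n + 1)) * htr - c * d ^ n * chebyshevSeq q w n * hdet

/-- Half of the trace of a normalized round, with `(b₀, b₁)`, `(c₁, s₁)`, `(c₂, s₂)` the cosines and
sines of half of the phases `β`, `α₁`, `α₂`. -/
def roundHalfTrace (p b₀ b₁ c₁ s₁ c₂ s₂ : ℝ) : ℝ :=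
  (b₀ ^ 2 - b₁ ^ 2) * (c₁ * c₂ - s₁ * s₂) + 2 * b₀ * b₁ * (s₁ * c₂ + c₁ * s₂) -
    4 * p * b₁ * (s₁ * (b₀ * c₂ + b₁ * s₂) + s₂ * (b₀ * c₁ + b₁ * s₁)) +
    8 * p ^ 2 * b₁ ^ 2 * s₁ * s₂

/-- The real part of the amplitude with which a normalized round preserves the constants. -/
def roundEntry (p b₀ b₁ c₁ s₁ c₂ s₂ : ℝ) : ℝ :=
  roundHalfTrace p b₀ b₁ c₁ s₁ c₂ s₂ - 4 * p * b₁ * s₁ * (b₀ * c₂ + b₁ * s₂) +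
    8 * p ^ 2 * b₁ ^ 2 * s₁ * s₂

/-- The imaginary part of the amplitude with which a normalized round preserves the constants. -/
def roundEntryIm (p b₀ b₁ c₁ s₁ c₂ s₂ : ℝ) : ℝ :=
  2 * b₀ * b₁ * (c₁ * c₂ - s₁ * s₂) - (b₀ ^ 2 - b₁ ^ 2) * (s₁ * c₂ + c₁ * s₂) -
    4 * p * b₁ * s₂ * (b₁ * c₁ - b₀ * s₁)

lemma exists_cos_sin_eq {x y : ℝ} (h : x ^ 2 + y ^ 2 = 1) :
    ∃ a : ℝ, Real.cos a = x ∧ Real.sin a = y := by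
  have hn : ‖(⟨x, y⟩ : ℂ)‖ = 1 := by
    rw [Complex.norm_def, Complex.normSq_mk, ← sq, ← sq, h, Real.sqrt_one]
  have h0 : (⟨x, y⟩ : ℂ) ≠ 0 := by
    intro h'
    rw [h', norm_zero] at hn
    exact zero_ne_one hn
  refine ⟨Complex.arg ⟨x, y⟩, ?_, ?_⟩
  · rw [Complex.cos_arg h0, hn, div_one]
  · rw [Complex.sin_arg, hn, div_one]

/-- The angle of rotation of a round with matching phases. -/
lemma four_arcsin_sqrt {x : ℝ} (hx0 : 0 < x) (hx : x ≤ 3 / 14) :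
    0 < 4 * Real.arcsin (Real.sqrt x) ∧ 4 * Real.arcsin (Real.sqrt x) < Real.pi ∧
      Real.cos (4 * Real.arcsin (Real.sqrt x)) = 1 - 8 * x + 8 * x ^ 2 ∧
      Real.cos (4 * Real.arcsin (Real.sqrt x) / 2) = 1 - 2 * x := by
  set g := 4 * Real.arcsin (Real.sqrt x) with hg
  have hsx : Real.sqrt x ^ 2 = x := Real.sq_sqrt hx0.le
  have hsx0 : 0 < Real.sqrt x := Real.sqrt_pos.2 hx0
  -- Since x < 1/4, the arcsine is at most π/6 and the angle at most 2π/3.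
  have hsx1 : Real.sqrt x ≤ 1 / 2 := by
    rw [Real.sqrt_le_left (by norm_num)]
    linarith
  have hsin : Real.sin (Real.arcsin (Real.sqrt x)) = Real.sqrt x :=
    Real.sin_arcsin (by linarith) (by linarith)
  have hg2 : Real.cos (g / 2) = 1 - 2 * x := by
    have : g / 2 = 2 * Real.arcsin (Real.sqrt x) := by rw [hg]; ring
    rw [this, Real.cos_two_mul, Real.cos_sq', hsin, hsx]
    ring
  refine ⟨?_, ?_, ?_, hg2⟩
  · have := Real.arcsin_pos.2 hsx0
    positivity
  · have h1 : Real.arcsin (Real.sqrt x) ≤ Real.arcsin (1 / 2) := Real.arcsin_le_arcsin hsx1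
    have h2 : Real.arcsin (1 / 2) = Real.pi / 6 := by
      rw [← Real.sin_pi_div_six, Real.arcsin_sin]
      · linarith [Real.pi_pos]
      · linarith [Real.pi_pos]
    rw [h2] at h1
    have := Real.pi_pos
    rw [hg]
    linarith
  · have : g = 2 * (g / 2) := by ring
    rw [this, Real.cos_two_mul, hg2]
    ring

/-! ### Marking phases by the intermediate value theorem -/

/-- With α₁ = α₂ = 2β, the half trace is cos g for g = 4 arcsin √(p sin² β), and the first term of
the sequence is at most cos g. For ng in [π/2, π] both terms of the closed form are then
nonpositive: the rotation has gone far enough. -/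
lemma chebyshevSeq_matching_nonpos {p b₀ b₁ : ℝ} (hbb : b₁ ^ 2 + b₀ ^ 2 = 1)
    (hx0 : 0 < p * b₁ ^ 2) (hx : p * b₁ ^ 2 ≤ 3 / 14) (n : ℕ)
    (hn : Real.pi / 2 ≤ n * (4 * Real.arcsin (Real.sqrt (p * b₁ ^ 2))))
    (hn' : n * (4 * Real.arcsin (Real.sqrt (p * b₁ ^ 2))) ≤ Real.pi) :
    chebyshevSeq (roundHalfTrace p b₀ b₁ b₀ b₁ b₀ b₁) (roundEntry p b₀ b₁ b₀ b₁ b₀ b₁) n ≤ 0 := by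
  obtain ⟨hg0, hgpi, hg1, -⟩ := four_arcsin_sqrt hx0 hx
  set g := 4 * Real.arcsin (Real.sqrt (p * b₁ ^ 2))
  have hgsin : 0 < Real.sin g := Real.sin_pos_of_pos_of_lt_pi hg0 hgpi
  have hq : roundHalfTrace p b₀ b₁ b₀ b₁ b₀ b₁ = Real.cos g := by
    rw [roundHalfTrace, hg1]
    linear_combination (1 + b₁ ^ 2 + b₀ ^ 2 - 8 * p * b₁ ^ 2) * hbb
  have hw : roundEntry p b₀ b₁ b₀ b₁ b₀ b₁ - Real.cos g =
      -(4 * (p * b₁ ^ 2) * (1 - 2 * (p * b₁ ^ 2))) := by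
    rw [← hq, roundEntry]
    linear_combination (-4 * p * b₁ ^ 2) * hbb
  have hw' : roundEntry p b₀ b₁ b₀ b₁ b₀ b₁ - Real.cos g ≤ 0 := by
    rw [hw, neg_nonpos]
    exact mul_nonneg (by linarith) (by linarith)
  rw [hq]
  have h2 : Real.cos (n * g) ≤ 0 :=
    Real.cos_nonpos_of_pi_div_two_le_of_le hn (by linarith [Real.pi_pos])
  have h3 : 0 ≤ Real.sin (n * g) := Real.sin_nonneg_of_nonneg_of_le_pi (by positivity) hn'
  refine nonpos_of_mul_nonpos_left ?_ hgsin
  rw [chebyshevSeq_cos_mul_sin]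
  exact add_nonpos (mul_nonpos_of_nonpos_of_nonneg h2 hgsin.le)
    (mul_nonpos_of_nonneg_of_nonpos h3 hw')

/-- With the first marking switched off, the first term equals the half trace q, so the n-th term is
cos (n arccos q). Since q ≥ 1 - 2x = cos (g/2), a round turns by at most g/2, and n rounds stay
within π/2: the rotation has not gone too far. -/
lemma chebyshevSeq_unmarked_nonneg {p b₀ b₁ R : ℝ} (hbb : b₁ ^ 2 + b₀ ^ 2 = 1)
    (hx0 : 0 < p * b₁ ^ 2) (hx : p * b₁ ^ 2 ≤ 3 / 14) (hb : b₀ ^ 2 ≤ 1 / 100) (hR : 0 < R)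
    (hR2 : R ^ 2 = (1 - 4 * (p * b₁ ^ 2)) ^ 2 + 16 * (p * b₁ ^ 2) * b₀ ^ 2) (n : ℕ)
    (hn : n * (4 * Real.arcsin (Real.sqrt (p * b₁ ^ 2))) ≤ Real.pi) :
    0 ≤ chebyshevSeq
      (roundHalfTrace p b₀ b₁ 1 0 ((2 * b₀ ^ 2 - 1 + 4 * (p * b₁ ^ 2)) / R) (2 * b₁ * b₀ / R))
      (roundEntry p b₀ b₁ 1 0 ((2 * b₀ ^ 2 - 1 + 4 * (p * b₁ ^ 2)) / R) (2 * b₁ * b₀ / R)) n := by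
  obtain ⟨hg0, hgpi, -, hg2⟩ := four_arcsin_sqrt hx0 hx
  set g := 4 * Real.arcsin (Real.sqrt (p * b₁ ^ 2))
  have hw : ∀ c s, roundEntry p b₀ b₁ 1 0 c s = roundHalfTrace p b₀ b₁ 1 0 c s := by
    intro c s
    rw [roundEntry]
    ring
  rw [hw]
  set q := roundHalfTrace p b₀ b₁ 1 0 ((2 * b₀ ^ 2 - 1 + 4 * (p * b₁ ^ 2)) / R)
    (2 * b₁ * b₀ / R) with hq
  have hq0 : q = (1 - 4 * (p * b₁ ^ 2)) / R := by
    rw [hq, roundHalfTrace, eq_div_iff hR.ne']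
    field_simp
    linear_combination (2 * b₀ ^ 2 + 1 - 4 * p * b₁ ^ 2) * hbb
  generalize p * b₁ ^ 2 = x at *
  have hq1 : q ≤ 1 := by
    rw [hq0, div_le_one hR]
    refine le_of_sq_le_sq ?_ hR.le
    rw [hR2]
    linarith [mul_nonneg hx0.le (sq_nonneg b₀)]
  have hq2 : 1 - 2 * x ≤ q := by
    rw [hq0, le_div_iff₀ hR]
    refine le_of_sq_le_sq ?_ (by linarith)
    rw [mul_pow, hR2]
    -- This is (1 - 2x)² R² ≤ (1 - 4x)² after cancelling 4x. The bound x ≤ 3/14 is what gives 1 - 2x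
    -- ≤ 4(1 - 4x).
    have h1 : 4 * (1 - 2 * x) ^ 2 * b₀ ^ 2 ≤ (1 - 4 * x) ^ 2 * (1 - x) := by
      have h2 : 4 * (1 - 2 * x) ^ 2 * b₀ ^ 2 ≤ 4 * (1 - 2 * x) ^ 2 * (1 / 100) := by gcongr
      have h3 : (1 - 2 * x) ≤ 4 * (1 - 4 * x) := by linarith
      have h4 : (1 - 2 * x) ^ 2 ≤ (4 * (1 - 4 * x)) ^ 2 := by
        apply pow_le_pow_left₀ _ h3
        linarith
      have h5 : (1 - 4 * x) ^ 2 * (11 / 14) ≤ (1 - 4 * x) ^ 2 * (1 - x) := by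
        gcongr
        linarith
      nlinarith [sq_nonneg (1 - 4 * x)]
    linarith [mul_le_mul_of_nonneg_left h1 (by linarith : (0 : ℝ) ≤ 4 * x)]
  have hacos : Real.cos (Real.arccos q) = q := Real.cos_arccos (by linarith) hq1
  rw [← hacos, chebyshevSeq_cos_cos]
  have hle : Real.arccos q ≤ g / 2 := by
    rw [← Real.arccos_cos (x := g / 2) (by linarith) (by linarith)]
    apply Real.arccos_le_arccos
    rw [hg2]
    exact hq2
  have h0 := Real.arccos_nonneg q
  apply Real.cos_nonneg_of_neg_pi_div_two_le_of_le
  · have : (0 : ℝ) ≤ n * Real.arccos q := by positivity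
    linarith [Real.pi_pos]
  · calc (n : ℝ) * Real.arccos q ≤ n * (g / 2) := by gcongr
      _ ≤ Real.pi / 2 := by linarith

/-- For a suitable number `n` of rounds, the phases of the marking operators can be chosen such that
the amplitude of the constants vanishes after `n` rounds. -/
lemma exists_marking_phases {p b : ℝ} (hp : 0 < p) (hp' : p ≤ 3 / 14)
    (hb : Real.cos b ^ 2 ≤ 1 / 100) (n : ℕ)
    (hn : Real.pi / 2 ≤ n * (4 * Real.arcsin (Real.sqrt (p * Real.sin b ^ 2))))
    (hn' : n * (4 * Real.arcsin (Real.sqrt (p * Real.sin b ^ 2))) ≤ Real.pi) :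
    ∃ a₁ a₂ : ℝ,
      roundEntryIm p (Real.cos b) (Real.sin b) (Real.cos a₁) (Real.sin a₁) (Real.cos a₂)
        (Real.sin a₂) = 0 ∧
      chebyshevSeq
        (roundHalfTrace p (Real.cos b) (Real.sin b) (Real.cos a₁) (Real.sin a₁) (Real.cos a₂)
          (Real.sin a₂))
        (roundEntry p (Real.cos b) (Real.sin b) (Real.cos a₁) (Real.sin a₁) (Real.cos a₂)
          (Real.sin a₂)) n = 0 := by
  set b₀ := Real.cos b with hb₀
  set b₁ := Real.sin b with hb₁
  have hbb : b₁ ^ 2 + b₀ ^ 2 = 1 := Real.sin_sq_add_cos_sq b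
  set x := p * b₁ ^ 2 with hx
  have hx0 : 0 < x := by
    have : 0 < b₁ ^ 2 := by linarith
    positivity
  have hxp : x ≤ 3 / 14 := by nlinarith [sq_nonneg b₀]
  -- The imaginary part of the entry is cos α · Y - sin α · X in the second half-phase α, so it
  -- vanishes when (cos α, sin α) = (X, Y)/R. This choice is continuous in the first half-phase as
  -- long as R > 0.
  let X : ℝ → ℝ := fun a => Real.cos (2 * b - a) + 4 * p * b₁ * Real.sin (b - a)
  let Y : ℝ → ℝ := fun a => Real.sin (2 * b - a)
  let R : ℝ → ℝ := fun a => Real.sqrt (X a ^ 2 + Y a ^ 2)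
  have hXY : ∀ a, 0 < X a ^ 2 + Y a ^ 2 := by
    intro a
    have h1 : |4 * p * b₁ * Real.sin (b - a)| ≤ 6 / 7 := by
      rw [abs_mul, abs_mul, abs_of_pos (by positivity : 0 < 4 * p)]
      have h2 : |b₁| ≤ 1 := Real.abs_sin_le_one b
      have h3 := Real.abs_sin_le_one (b - a)
      calc 4 * p * |b₁| * |Real.sin (b - a)| ≤ 4 * p * 1 * 1 := by gcongr
        _ ≤ 6 / 7 := by linarith
    -- If Y = 0 then the cosine in X is ±1, which a term of size at most 6/7 cannot cancel.
    by_contra! h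
    have hX : X a = 0 := by nlinarith [sq_nonneg (X a), sq_nonneg (Y a)]
    have hY : Y a = 0 := by nlinarith [sq_nonneg (X a), sq_nonneg (Y a)]
    have h4 := Real.sin_sq_add_cos_sq (2 * b - a)
    have h5 : Real.cos (2 * b - a) = -(4 * p * b₁ * Real.sin (b - a)) := by
      simp only [X] at hX
      linarith
    simp only [Y] at hY
    rw [hY, h5] at h4
    rw [abs_le] at h1
    nlinarith
  have hR : ∀ a, 0 < R a := fun a => Real.sqrt_pos.2 (hXY a)
  have hR2 : ∀ a, R a ^ 2 = X a ^ 2 + Y a ^ 2 := fun a => Real.sq_sqrt (hXY a).le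
  have hXc : Continuous X := by fun_prop
  have hYc : Continuous Y := by fun_prop
  have hRc : Continuous R := by fun_prop
  have hXRc : Continuous fun a => X a / R a := hXc.div hRc fun a => (hR a).ne'
  have hYRc : Continuous fun a => Y a / R a := hYc.div hRc fun a => (hR a).ne'
  let q : ℝ → ℝ := fun a =>
    roundHalfTrace p b₀ b₁ (Real.cos a) (Real.sin a) (X a / R a) (Y a / R a)
  let w : ℝ → ℝ := fun a =>
    roundEntry p b₀ b₁ (Real.cos a) (Real.sin a) (X a / R a) (Y a / R a)
  have hqc : Continuous q := by
    simp only [q, roundHalfTrace]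
    fun_prop
  have hwc : Continuous w := by
    simp only [w, roundEntry, roundHalfTrace]
    fun_prop
  have hF := continuous_chebyshevSeq hqc hwc n
  -- At a = b the second half-phase is b as well.
  have hend₁ : chebyshevSeq (q b) (w b) n ≤ 0 := by
    have hXb : X b = b₀ := by
      simp only [X]
      rw [show 2 * b - b = b by ring, sub_self, Real.sin_zero]
      ring
    have hYb : Y b = b₁ := by
      simp only [Y]
      rw [show 2 * b - b = b by ring]
    have hRb : R b = 1 := by
      simp only [R, hXb, hYb]
      rw [add_comm, hbb, Real.sqrt_one]
    have h := chebyshevSeq_matching_nonpos hbb hx0 hxp n hn hn'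
    simp only [q, w, hXb, hYb, hRb, div_one, ← hb₀, ← hb₁]
    exact h
  have hend₂ : 0 ≤ chebyshevSeq (q 0) (w 0) n := by
    have hX0 : X 0 = Real.cos (2 * b) + 4 * x := by
      simp only [X, sub_zero, ← hb₁, hx]
      ring
    have hY0 : Y 0 = 2 * b₁ * b₀ := by
      simp only [Y, sub_zero, Real.sin_two_mul, ← hb₁, ← hb₀]
    have hX0' : X 0 = 2 * b₀ ^ 2 - 1 + 4 * x := by
      rw [hX0, Real.cos_two_mul]
    have hR0 : R 0 ^ 2 = (1 - 4 * x) ^ 2 + 16 * x * b₀ ^ 2 := by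
      rw [hR2, hX0', hY0]
      linear_combination 4 * b₀ ^ 2 * hbb
    have h := chebyshevSeq_unmarked_nonneg hbb hx0 hxp hb (hR 0) hR0 n hn'
    simp only [q, w, hX0', hY0, Real.cos_zero, Real.sin_zero]
    exact h
  obtain ⟨a, ha⟩ := mem_range_of_exists_le_of_exists_ge hF ⟨b, hend₁⟩ ⟨0, hend₂⟩
  obtain ⟨a₂, hc, hs⟩ : ∃ a₂ : ℝ, Real.cos a₂ = X a / R a ∧ Real.sin a₂ = Y a / R a := by
    apply exists_cos_sin_eq
    rw [div_pow, div_pow, ← add_div, ← hR2, div_self (pow_ne_zero 2 (hR a).ne')]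
  refine ⟨a, a₂, ?_, ?_⟩
  · rw [hc, hs, roundEntryIm]
    have hRa := (hR a).ne'
    have h1 : Y a = 2 * b₀ * b₁ * Real.cos a - (b₀ ^ 2 - b₁ ^ 2) * Real.sin a := by
      simp only [Y, Real.sin_sub, Real.sin_two_mul, Real.cos_two_mul, ← hb₀, ← hb₁]
      linear_combination -Real.sin a * hbb
    have h2 : X a = (b₀ ^ 2 - b₁ ^ 2) * Real.cos a + 2 * b₀ * b₁ * Real.sin a +
        4 * p * b₁ * (b₁ * Real.cos a - b₀ * Real.sin a) := by
      simp only [X, Real.cos_sub, Real.sin_sub, Real.sin_two_mul, Real.cos_two_mul, ← hb₀, ← hb₁]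
      linear_combination Real.cos a * hbb
    field_simp
    rw [h1, h2]
    ring
  · rw [hc, hs]
    exact ha

/-- The diagonal entry of a round in the basis of the constants and the marked indicator, divided by
a square root of the determinant. Half-angles enter through e^{2iz} - 1 = e^{iz} · 2i sin z. The
other diagonal entry is the complex conjugate up to a real number, so the normalized trace is real.
-/
lemma round_topLeft (p b₀ b₁ c₁ s₁ c₂ s₂ : ℝ) :
    ((b₀ + b₁ * Complex.I) * (c₂ - s₂ * Complex.I) +
        (2 * b₁ * Complex.I) * p * (2 * s₂ * Complex.I)) *
      ((b₀ + b₁ * Complex.I) * (c₁ - s₁ * Complex.I) +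
        (2 * b₁ * Complex.I) * p * (2 * s₁ * Complex.I)) +
      (2 * b₁ * Complex.I) * p * (c₂ + s₂ * Complex.I) *
        ((b₀ - b₁ * Complex.I) * (2 * s₁ * Complex.I)) =
    (roundEntry p b₀ b₁ c₁ s₁ c₂ s₂ : ℂ) + roundEntryIm p b₀ b₁ c₁ s₁ c₂ s₂ * Complex.I := by
  rw [roundEntry, roundEntryIm, roundHalfTrace]
  apply Complex.ext
  · simp [pow_two]
    ring
  · simp [pow_two]
    ring

lemma round_bottomRight (p b₀ b₁ c₁ s₁ c₂ s₂ : ℝ) :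
    (b₀ - b₁ * Complex.I) * (c₂ + s₂ * Complex.I) *
        ((b₀ - b₁ * Complex.I) * (c₁ + s₁ * Complex.I)) +
      (b₀ - b₁ * Complex.I) * (2 * s₂ * Complex.I) *
        ((2 * b₁ * Complex.I) * p * (c₁ + s₁ * Complex.I)) =
    (2 * roundHalfTrace p b₀ b₁ c₁ s₁ c₂ s₂ - roundEntry p b₀ b₁ c₁ s₁ c₂ s₂ : ℂ) -
      roundEntryIm p b₀ b₁ c₁ s₁ c₂ s₂ * Complex.I := by
  rw [roundEntry, roundEntryIm, roundHalfTrace]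
  apply Complex.ext
  · simp [pow_two]
    ring
  · simp [pow_two]
    ring

lemma exp_two_mul_mul_I (b : ℝ) : Complex.exp ((2 * b : ℝ) * Complex.I) =
    (Real.cos b + Real.sin b * Complex.I) ^ 2 := by
  rw [Complex.ofReal_cos, Complex.ofReal_sin, ← Complex.exp_mul_I, ← Complex.exp_nat_mul]
  congr 1
  push_cast
  ring

lemma cos_add_sin_mul_cos_sub_sin (b : ℝ) :
    ((Real.cos b : ℂ) + Real.sin b * Complex.I) * (Real.cos b - Real.sin b * Complex.I) = 1 := by
  have h : ((Real.sin b ^ 2 + Real.cos b ^ 2 : ℝ) : ℂ) = 1 := by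
    rw [Real.sin_sq_add_cos_sq, Complex.ofReal_one]
  push_cast at h ⊢
  linear_combination h - (Complex.sin b) ^ 2 * Complex.I_sq

/-- If `inner` steps of the walk act as a phase rotation about the constants, and the amplitude of
the constants vanishes after the last round, then only marked vertices remain. -/
lemma vertexRound_iterate_eq_zero {N r M : ℕ} (P : WalkParams) (x : Fin N → Fin M) {i j : Fin N}
    (hx : ∀ v : Vertex N r, HasCollision x v ↔ i ∈ v.1.1 ∧ j ∈ v.1.1) {p b a₁ a₂ : ℝ} {c : ℂ}
    (hα₁ : P.α₁ = 2 * a₁) (hα₂ : P.α₂ = 2 * a₂)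
    (hone : (vertexStep N r (Complex.exp (P.θ₁ * Complex.I)) (Complex.exp (P.θ₂ * Complex.I)) ^
      P.inner) (fun _ => 1) = fun _ => c * Complex.exp ((2 * b : ℝ) * Complex.I))
    (hpair : (vertexStep N r (Complex.exp (P.θ₁ * Complex.I)) (Complex.exp (P.θ₂ * Complex.I)) ^
      P.inner) (pairIndicator N r i j) = fun v => c * pairIndicator N r i j v +
        (c * Complex.exp ((2 * b : ℝ) * Complex.I) - c) * p)
    (him : roundEntryIm p (Real.cos b) (Real.sin b) (Real.cos a₁) (Real.sin a₁) (Real.cos a₂)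
        (Real.sin a₂) = 0)
    (hcheb : chebyshevSeq
        (roundHalfTrace p (Real.cos b) (Real.sin b) (Real.cos a₁) (Real.sin a₁) (Real.cos a₂)
          (Real.sin a₂))
        (roundEntry p (Real.cos b) (Real.sin b) (Real.cos a₁) (Real.sin a₁) (Real.cos a₂)
          (Real.sin a₂)) P.outer = 0)
    (c₀ : ℂ) (v : Vertex N r) (hv : ¬ HasCollision x v) :
    (vertexRound P x)^[P.outer] (fun _ => c₀) v = 0 := by
  classical
  set u := vertexStep N r (Complex.exp (P.θ₁ * Complex.I)) (Complex.exp (P.θ₂ * Complex.I))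
    with hu
  let plane : ℂ × ℂ → Vertex N r → ℂ := fun y v => y.1 + y.2 * pairIndicator N r i j v
  have hmark : ∀ (e : ℂ) (y : ℂ × ℂ),
      vertexMark x e (plane y) = plane (y.1, (e - 1) * y.1 + e * y.2) := by
    intro e y
    funext v
    simp only [vertexMark, plane, pairIndicator, hx]
    split_ifs
    · ring
    · ring
  obtain ⟨L, hL⟩ : ∃ L, L = c * Complex.exp ((2 * b : ℝ) * Complex.I) := ⟨_, rfl⟩
  rw [← hL] at hone hpair
  have hrot : ∀ y : ℂ × ℂ, (u ^ P.inner) (plane y) =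
      plane (L * y.1 + (L - c) * p * y.2, c * y.2) := by
    intro y
    have hy : plane y = y.1 • (fun _ => (1 : ℂ)) + y.2 • pairIndicator N r i j := by
      funext v
      simp [plane]
    rw [hy, map_add, map_smul, map_smul, hone, hpair]
    funext v
    simp only [Pi.add_apply, Pi.smul_apply, smul_eq_mul, plane]
    ring
  obtain ⟨e₁, he₁⟩ : ∃ e, e = Complex.exp (P.α₁ * Complex.I) := ⟨_, rfl⟩
  obtain ⟨e₂, he₂⟩ : ∃ e, e = Complex.exp (P.α₂ * Complex.I) := ⟨_, rfl⟩
  let f : ℂ × ℂ → ℂ × ℂ := fun y =>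
    (((L + (L - c) * p * (e₂ - 1)) * (L + (L - c) * p * (e₁ - 1)) +
        (L - c) * p * e₂ * (c * (e₁ - 1))) * y.1 +
      ((L + (L - c) * p * (e₂ - 1)) * ((L - c) * p * e₁) +
        (L - c) * p * e₂ * (c * e₁)) * y.2,
    (c * (e₂ - 1) * (L + (L - c) * p * (e₁ - 1)) + c * e₂ * (c * (e₁ - 1))) * y.1 +
      (c * (e₂ - 1) * ((L - c) * p * e₁) + c * e₂ * (c * e₁)) * y.2)
  have hround : ∀ y, vertexRound P x (plane y) = plane (f y) := by
    intro y
    simp only [vertexRound]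
    rw [← hu, ← he₁, ← he₂, hmark, hrot, hmark, hrot]
    congr 1
    ext
    · simp only [f]
      ring
    · simp only [f]
      ring
  have hiter : ∀ n y, (vertexRound P x)^[n] (plane y) = plane (f^[n] y) := by
    intro n y
    induction n with
    | zero => rfl
    | succ n ih => rw [Function.iterate_succ_apply', ih, hround, Function.iterate_succ_apply']
  have hstart : (fun _ => c₀ : Vertex N r → ℂ) = plane (c₀, 0) := by
    funext v
    simp [plane]
  have hv' : pairIndicator N r i j v = 0 := by
    rw [pairIndicator, if_neg]
    rwa [← hx]
  rw [hstart, hiter]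
  simp only [plane, hv', mul_zero, add_zero]
  rw [hα₁, exp_two_mul_mul_I] at he₁
  rw [hα₂, exp_two_mul_mul_I] at he₂
  rw [exp_two_mul_mul_I] at hL
  have hε := cos_add_sin_mul_cos_sub_sin b
  have hf₁ := cos_add_sin_mul_cos_sub_sin a₁
  have hf₂ := cos_add_sin_mul_cos_sub_sin a₂
  have htl := round_topLeft p (Real.cos b) (Real.sin b) (Real.cos a₁) (Real.sin a₁) (Real.cos a₂)
    (Real.sin a₂)
  have hbr := round_bottomRight p (Real.cos b) (Real.sin b) (Real.cos a₁) (Real.sin a₁)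
    (Real.cos a₂) (Real.sin a₂)
  rw [him, Complex.ofReal_zero, zero_mul, add_zero] at htl
  rw [him, Complex.ofReal_zero, zero_mul, sub_zero] at hbr
  have hd : ∀ z : ℝ, (2 * Real.sin z * Complex.I : ℂ) =
      (Real.cos z + Real.sin z * Complex.I) - (Real.cos z - Real.sin z * Complex.I) := by
    intro z
    ring
  rw [hd, hd, hd] at htl
  rw [hd, hd] at hbr
  generalize (Real.cos b + Real.sin b * Complex.I : ℂ) = ε at *
  generalize (Real.cos b - Real.sin b * Complex.I : ℂ) = ε' at *
  generalize (Real.cos a₁ + Real.sin a₁ * Complex.I : ℂ) = f₁ at *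
  generalize (Real.cos a₁ - Real.sin a₁ * Complex.I : ℂ) = f₁' at *
  generalize (Real.cos a₂ + Real.sin a₂ * Complex.I : ℂ) = f₂ at *
  generalize (Real.cos a₂ - Real.sin a₂ * Complex.I : ℂ) = f₂' at *
  subst hL he₁ he₂
  -- Factoring each difference of phases pulls the common factor d = c²ε²f₁f₂ out of both diagonal
  -- entries; d² is the determinant of the round.
  have hLc : c * ε ^ 2 - c = c * ε * (ε - ε') := by linear_combination c * hε
  have h₁ : f₁ ^ 2 - 1 = f₁ * (f₁ - f₁') := by linear_combination hf₁
  have h₂ : f₂ ^ 2 - 1 = f₂ * (f₂ - f₂') := by linear_combination hf₂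
  have hA : (c * ε ^ 2 + (c * ε ^ 2 - c) * p * (f₂ ^ 2 - 1)) *
        (c * ε ^ 2 + (c * ε ^ 2 - c) * p * (f₁ ^ 2 - 1)) +
      (c * ε ^ 2 - c) * p * f₂ ^ 2 * (c * (f₁ ^ 2 - 1)) = c ^ 2 * ε ^ 2 * f₁ * f₂ *
      roundEntry p (Real.cos b) (Real.sin b) (Real.cos a₁) (Real.sin a₁) (Real.cos a₂)
        (Real.sin a₂) := by
    rw [← htl, hLc, h₁, h₂]
    linear_combination
      (-(c * ε ^ 2) * (c * ε ^ 2 * (f₁ * f₁') + c * ε * (ε - ε') * p * (f₁ * (f₁ - f₁')))) * hf₂ -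
      (c * ε ^ 2 + c * ε * (ε - ε') * p * (f₂ * (f₂ - f₂'))) * (c * ε ^ 2) * hf₁ -
      c ^ 2 * ε * f₁ * f₂ ^ 2 * (ε - ε') * p * (f₁ - f₁') * hε
  have hD : c * (f₂ ^ 2 - 1) * ((c * ε ^ 2 - c) * p * f₁ ^ 2) + c * f₂ ^ 2 * (c * f₁ ^ 2) =
      c ^ 2 * ε ^ 2 * f₁ * f₂ *
      (2 * roundHalfTrace p (Real.cos b) (Real.sin b) (Real.cos a₁) (Real.sin a₁) (Real.cos a₂)
        (Real.sin a₂) - roundEntry p (Real.cos b) (Real.sin b) (Real.cos a₁) (Real.sin a₁)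
          (Real.cos a₂) (Real.sin a₂)) := by
    rw [← hbr, hLc, h₂]
    linear_combination (-c ^ 2 * f₁ ^ 2 * f₂ ^ 2 * (ε * ε' + 1) -
      c ^ 2 * ε * f₁ ^ 2 * f₂ * (f₂ - f₂') * (ε - ε') * p) * hε
  rw [iterate_fst_eq_chebyshevSeq (q := roundHalfTrace p (Real.cos b) (Real.sin b) (Real.cos a₁)
    (Real.sin a₁) (Real.cos a₂) (Real.sin a₂)) hA (by rw [hA, hD]; ring) (by ring) f
    (fun y => rfl) c₀ P.outer, hcheb]
  simp

/-! ### The phases of the walk -/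

/-- What the phases `θ₁`, `θ₂` and the number `t` of steps of the walk have to satisfy: on the two
nontrivial blocks of the invariant subspace, `t` steps act as the same scalar `c`, and the constants
pick up the phase `2 b` relative to `c`. -/
def ArePhases (N r t : ℕ) (θ₁ θ₂ b : ℝ) (c : ℂ) : Prop :=
  (Complex.exp (θ₁ * Complex.I) * Complex.exp (θ₂ * Complex.I)) ^ t =
      c * Complex.exp ((2 * b : ℝ) * Complex.I) ∧
    ∃ l l' : ℕ → ℂ, ∀ k, k = 1 ∨ k = 2 → l k ≠ l' k ∧
      l k * l' k = Complex.exp (θ₁ * Complex.I) * Complex.exp (θ₂ * Complex.I) ∧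
      l k + l' k = Complex.exp (θ₁ * Complex.I) + Complex.exp (θ₂ * Complex.I) +
        (1 - Complex.exp (θ₁ * Complex.I)) * (1 - Complex.exp (θ₂ * Complex.I)) *
          walkEigenvalue N r k ∧
      l k ^ t = c ∧ l' k ^ t = c

/-- For these phases e₁e₂ = e^{2iη}, e₁ + e₂ = -2e^{iη} cos D and (1 - e₁)(1 - e₂) = 2e^{iη}(cos D +
cos η). The quadratic of block k thus has roots e^{i(η ± δ_k)}, whose t-th powers both equal e^{itη}
once tδ_k is a multiple of 2π; sin δ_k ≠ 0 makes the roots distinct. -/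
lemma arePhases_of_angles {N r t : ℕ} {η D : ℝ} {δ : ℕ → ℝ}
    (hδ : ∀ k, k = 1 ∨ k = 2 → Real.sin (δ k) ≠ 0 ∧
      Real.cos D - (Real.cos D + Real.cos η) * walkEigenvalue N r k = -Real.cos (δ k) ∧
      ∃ n : ℕ, t * δ k = n * (2 * Real.pi)) :
    ArePhases N r t (Real.pi + η + D) (Real.pi + η - D) (t * η / 2)
      (Complex.exp ((t * η : ℝ) * Complex.I)) := by
  have he₁ : Complex.exp ((Real.pi + η + D : ℝ) * Complex.I) =
      -(Complex.exp (η * Complex.I) * Complex.exp (D * Complex.I)) := by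
    rw [← Complex.exp_add]
    have : ((Real.pi + η + D : ℝ) * Complex.I : ℂ) =
        (η * Complex.I + D * Complex.I) + Real.pi * Complex.I := by
      push_cast
      ring
    rw [this, Complex.exp_add _ (Real.pi * Complex.I), Complex.exp_pi_mul_I]
    ring
  have he₂ : Complex.exp ((Real.pi + η - D : ℝ) * Complex.I) =
      -(Complex.exp (η * Complex.I) * Complex.exp (-(D * Complex.I))) := by
    rw [← Complex.exp_add]
    have : ((Real.pi + η - D : ℝ) * Complex.I : ℂ) =
        (η * Complex.I + -(D * Complex.I)) + Real.pi * Complex.I := by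
      push_cast
      ring
    rw [this, Complex.exp_add _ (Real.pi * Complex.I), Complex.exp_pi_mul_I]
    ring
  have hinv : ∀ z : ℂ, Complex.exp z * Complex.exp (-z) = 1 := fun z => by
    rw [← Complex.exp_add, add_neg_cancel, Complex.exp_zero]
  have hcos : ∀ z : ℝ, (2 * Real.cos z : ℂ) =
      Complex.exp (z * Complex.I) + Complex.exp (-(z * Complex.I)) := fun z => by
    rw [Complex.ofReal_cos, Complex.two_cos, neg_mul]
  have hprod : Complex.exp ((Real.pi + η + D : ℝ) * Complex.I) *
      Complex.exp ((Real.pi + η - D : ℝ) * Complex.I) = Complex.exp (η * Complex.I) ^ 2 := by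
    rw [he₁, he₂]
    linear_combination Complex.exp (η * Complex.I) ^ 2 * hinv (D * Complex.I)
  have hηt : Complex.exp ((t * η : ℝ) * Complex.I) = Complex.exp (η * Complex.I) ^ t := by
    rw [← Complex.exp_nat_mul]
    congr 1
    push_cast
    ring
  refine ⟨?_, fun k => Complex.exp (η * Complex.I) * Complex.exp (-(δ k * Complex.I)),
    fun k => Complex.exp (η * Complex.I) * Complex.exp (δ k * Complex.I), ?_⟩
  · rw [hprod, show (2 * (t * η / 2) : ℝ) = t * η by ring, hηt]
    ring
  · intro k hk
    obtain ⟨hs, hc, n, hn⟩ := hδ k hk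
    have hpow : Complex.exp (δ k * Complex.I) ^ t = 1 := by
      rw [← Complex.exp_nat_mul, Complex.exp_eq_one_iff]
      refine ⟨n, ?_⟩
      have : (t * δ k : ℂ) = n * (2 * Real.pi) := by exact_mod_cast hn
      push_cast
      linear_combination Complex.I * this
    have hpow' : Complex.exp (-(δ k * Complex.I)) ^ t = 1 := by
      rw [Complex.exp_neg, inv_pow, hpow, inv_one]
    refine ⟨?_, ?_, ?_, ?_, ?_⟩
    · intro h
      have h1 := mul_left_cancel₀ (Complex.exp_ne_zero _) h
      apply hs
      have h2 : (2 * Complex.I) * Complex.sin (δ k) = 0 := by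
        rw [show (2 * Complex.I) * Complex.sin (δ k) = (2 * Complex.sin (δ k)) * Complex.I by ring,
          Complex.two_sin]
        rw [neg_mul, h1]
        ring
      have h3 : Complex.sin (δ k) = 0 := by simpa using h2
      exact_mod_cast h3
    · rw [hprod]
      linear_combination Complex.exp (η * Complex.I) ^ 2 * hinv (δ k * Complex.I)
    · rw [he₁, he₂]
      have hc' : (Real.cos D - (Real.cos D + Real.cos η) * walkEigenvalue N r k : ℂ) =
          -Real.cos (δ k) := by exact_mod_cast hc
      linear_combination (-Complex.exp (η * Complex.I)) * hcos (δ k) +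
        2 * Complex.exp (η * Complex.I) * hc' +
        Complex.exp (η * Complex.I) * (walkEigenvalue N r k - 1) * hcos D +
        Complex.exp (η * Complex.I) * walkEigenvalue N r k * hcos η -
        Complex.exp (η * Complex.I) ^ 2 * walkEigenvalue N r k * hinv (D * Complex.I) +
        walkEigenvalue N r k * hinv (η * Complex.I)
    · rw [mul_pow, hpow', hηt, mul_one]
    · rw [mul_pow, hpow, hηt, mul_one]

/-! ### Estimates for the rotation angles -/

lemma sq_sub_le_sin_sq {z : ℝ} (h0 : 0 ≤ z) (h1 : z ≤ 1) :
    z ^ 2 - z ^ 4 / 2 ≤ Real.sin z ^ 2 := by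
  rcases h0.eq_or_lt with rfl | h0
  · simp
  have h := (Real.sin_gt_sub_cube h0).le
  have h2 : 0 ≤ z - z ^ 3 / 6 := by
    have h3 : z ^ 3 ≤ z := by simpa using pow_le_pow_of_le_one h0.le h1 (by norm_num : 1 ≤ 3)
    linarith
  calc z ^ 2 - z ^ 4 / 2 ≤ (z - z ^ 3 / 6) ^ 2 := by
        linarith [sq_nonneg (z ^ 3), sq_nonneg (z ^ 2)]
    _ ≤ Real.sin z ^ 2 := pow_le_pow_left₀ h2 h 2

lemma sin_sq_le_sq {z : ℝ} : Real.sin z ^ 2 ≤ z ^ 2 :=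
  sq_le_sq.2 Real.abs_sin_le_abs

/-- If `Y` is close to `(v h)²` with `h = π / (2 t)` and `v` close to an odd integer, then
`cos (t arcsin √Y)` is small. -/
lemma cos_mul_arcsin_sqrt_sq_le {Y v h B : ℝ} {t V : ℕ} (ht : 0 < t)
    (hh : h = Real.pi / (2 * t)) (hV : Odd V) (hv : 1 ≤ v) (hvV : |v - V| ≤ 1 / 20)
    (hvB : v + 1 / 100 ≤ B) (hB : B ^ 4 * h ^ 2 ≤ 1 / 200) (hBh : B * h ≤ 1)
    (hY : |Y - v ^ 2 * h ^ 2| ≤ 2 * B ^ 4 * h ^ 4) :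
    Real.cos (t * Real.arcsin (Real.sqrt Y)) ^ 2 ≤ 1 / 100 := by
  have htr : (0 : ℝ) < t := by exact_mod_cast ht
  have hpi := Real.pi_pos
  have hh0 : 0 < h := by rw [hh]; positivity
  have hth : t * h = Real.pi / 2 := by rw [hh]; field_simp
  rw [abs_le] at hY
  -- The error in Y is therefore at most h²/100, and the arcsine lies within h/100 of v h.
  have hB4 : B ^ 4 * h ^ 4 ≤ 1 / 200 * h ^ 2 := by nlinarith [sq_nonneg h]
  have hup : Real.arcsin (Real.sqrt Y) ≤ v * h + h / 100 := by
    have hz0 : 0 ≤ v * h + h / 100 := by positivity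
    have hz1 : v * h + h / 100 ≤ B * h := by nlinarith
    rw [Real.arcsin_le_iff_le_sin' ⟨by linarith, by linarith [Real.pi_gt_three]⟩]
    have hs0 : 0 ≤ Real.sin (v * h + h / 100) :=
      Real.sin_nonneg_of_nonneg_of_le_pi hz0 (by linarith [Real.pi_gt_three])
    rw [Real.sqrt_le_left hs0]
    refine le_trans ?_ (sq_sub_le_sin_sq hz0 (hz1.trans hBh))
    have h4 : (v * h + h / 100) ^ 4 ≤ (B * h) ^ 4 := pow_le_pow_left₀ hz0 hz1 4
    rw [mul_pow] at h4
    nlinarith [mul_le_mul_of_nonneg_right hv (sq_nonneg h)]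
  have hlow : v * h - h / 100 ≤ Real.arcsin (Real.sqrt Y) := by
    have hz0 : 0 ≤ v * h - h / 100 := by nlinarith
    have hz1 : v * h - h / 100 ≤ B * h := by nlinarith
    rw [Real.le_arcsin_iff_sin_le' ⟨by linarith, by linarith [Real.pi_gt_three]⟩]
    apply Real.le_sqrt_of_sq_le
    refine sin_sq_le_sq.trans ?_
    nlinarith [mul_le_mul_of_nonneg_right hv (sq_nonneg h)]
  obtain ⟨n, rfl⟩ := hV
  set z := Real.arcsin (Real.sqrt Y)
  have hcos : Real.cos (t * z) ^ 2 = Real.sin (t * z - (2 * n + 1) * (Real.pi / 2)) ^ 2 := by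
    have h1 : t * z = (t * z - (2 * n + 1) * (Real.pi / 2)) + Real.pi / 2 + n * Real.pi := by ring
    rw [show Real.cos (t * z) = Real.cos ((t * z - (2 * n + 1) * (Real.pi / 2)) + Real.pi / 2 +
      n * Real.pi) by rw [← h1], Real.cos_add_nat_mul_pi, Real.cos_add_pi_div_two, mul_pow, ← pow_mul, mul_comm n 2,
      pow_mul]
    simp
  rw [hcos]
  refine sin_sq_le_sq.trans ?_
  -- The deviation is at most (1/100 + 1/20) π/2 < 1/10.
  have h2 : |t * z - (2 * n + 1) * (Real.pi / 2)| ≤ 1 / 10 := by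
    have h3 : t * z ≤ t * (v * h + h / 100) := by gcongr
    have h4 : t * (v * h - h / 100) ≤ t * z := by gcongr
    have h5 : t * (v * h + h / 100) = (v + 1 / 100) * (Real.pi / 2) := by rw [← hth]; ring
    have h6 : t * (v * h - h / 100) = (v - 1 / 100) * (Real.pi / 2) := by rw [← hth]; ring
    rw [abs_le] at hvV ⊢
    push_cast at hvV
    have := Real.pi_lt_d2
    constructor <;> nlinarith
  calc (t * z - (2 * n + 1) * (Real.pi / 2)) ^ 2 = |t * z - (2 * n + 1) * (Real.pi / 2)| ^ 2 :=
        (sq_abs _).symm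
    _ ≤ (1 / 10) ^ 2 := pow_le_pow_left₀ (abs_nonneg _) h2 2
    _ = 1 / 100 := by norm_num

/-- sin² z falls short of z² by at most z⁴/2, and the coefficients are at most 8/3 and 5/3 in size.
The bound 5/3 on κ = N/(N - 2) is the one for N ≥ 5. -/
lemma abs_sin_sq_combination_le {κ z₁ z₂ : ℝ} (hκ0 : 0 ≤ κ) (hκ1 : κ ≤ 5 / 3) (h0 : 0 ≤ z₁)
    (h : z₁ ≤ z₂) (h1 : z₂ ≤ 1) :
    |Real.sin z₁ ^ 2 - (Real.sin z₂ ^ 2 - Real.sin z₁ ^ 2) * κ -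
      (z₁ ^ 2 - (z₂ ^ 2 - z₁ ^ 2) * κ)| ≤ 2 * z₂ ^ 4 := by
  have e : Real.sin z₁ ^ 2 - (Real.sin z₂ ^ 2 - Real.sin z₁ ^ 2) * κ -
      (z₁ ^ 2 - (z₂ ^ 2 - z₁ ^ 2) * κ) =
      (1 + κ) * (Real.sin z₁ ^ 2 - z₁ ^ 2) - κ * (Real.sin z₂ ^ 2 - z₂ ^ 2) := by ring
  have hl₁ := sq_sub_le_sin_sq h0 (h.trans h1)
  have hl₂ := sq_sub_le_sin_sq (h0.trans h) h1
  have hu₁ : Real.sin z₁ ^ 2 ≤ z₁ ^ 2 := sin_sq_le_sq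
  have hu₂ : Real.sin z₂ ^ 2 ≤ z₂ ^ 2 := sin_sq_le_sq
  have h4 : z₁ ^ 4 ≤ z₂ ^ 4 := pow_le_pow_left₀ h0 h 4
  have h40 : 0 ≤ z₂ ^ 4 := by positivity
  have hκ4 : κ * z₂ ^ 4 ≤ 5 / 3 * z₂ ^ 4 := by gcongr
  rw [e, abs_le]
  constructor
  · have h5 : (1 + κ) * (-(z₂ ^ 4 / 2)) ≤ (1 + κ) * (Real.sin z₁ ^ 2 - z₁ ^ 2) := by
      gcongr
      linarith
    have h6 : κ * (Real.sin z₂ ^ 2 - z₂ ^ 2) ≤ 0 :=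
      mul_nonpos_of_nonneg_of_nonpos hκ0 (by linarith)
    linarith
  · have h5 : κ * (-(z₂ ^ 4 / 2)) ≤ κ * (Real.sin z₂ ^ 2 - z₂ ^ 2) := by
      gcongr
      linarith
    have h6 : (1 + κ) * (Real.sin z₁ ^ 2 - z₁ ^ 2) ≤ 0 :=
      mul_nonpos_of_nonneg_of_nonpos (by linarith) (by linarith)
    linarith

/-- Put cos η = 1 - 2Y and cos D + cos η = 2S. The two conditions become A_k = Y + S μ_k with μ₁ =
N/((r+1)(N-r)) and μ₂ - μ₁ = (N-2)/((r+1)(N-r)). This linear system gives the S and Y of the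
hypotheses, which ensure that the arcsine and the arccosine exist. -/
lemma exists_angles {N r : ℕ} {A₁ A₂ : ℝ} (hr : 2 ≤ r) (hrN : r < N)
    (hY : 0 ≤ A₁ - (A₂ - A₁) * (N / (N - 2)))
    (hS : 0 ≤ (A₂ - A₁) * ((r + 1) * (N - r) / (N - 2)))
    (hSY : (A₂ - A₁) * ((r + 1) * (N - r) / (N - 2)) + (A₁ - (A₂ - A₁) * (N / (N - 2))) ≤ 1) :
    ∃ η D : ℝ, η = 2 * Real.arcsin (Real.sqrt (A₁ - (A₂ - A₁) * (N / (N - 2)))) ∧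
      Real.cos D - (Real.cos D + Real.cos η) * walkEigenvalue N r 1 = -(1 - 2 * A₁) ∧
      Real.cos D - (Real.cos D + Real.cos η) * walkEigenvalue N r 2 = -(1 - 2 * A₂) := by
  have hr' : (2 : ℝ) ≤ r := by exact_mod_cast hr
  have hrN' : (r : ℝ) < N := by exact_mod_cast hrN
  have hN2 : (N : ℝ) - 2 ≠ 0 := by linarith
  have hNr : (N : ℝ) - r ≠ 0 := by linarith
  have hr1 : (r : ℝ) + 1 ≠ 0 := by linarith
  set Y := A₁ - (A₂ - A₁) * (N / (N - 2)) with hYd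
  set S := (A₂ - A₁) * ((r + 1) * (N - r) / (N - 2)) with hSd
  have hcosη : Real.cos (2 * Real.arcsin (Real.sqrt Y)) = 1 - 2 * Y := by
    have h1 : Real.sqrt Y ≤ 1 := by
      rw [Real.sqrt_le_left zero_le_one]
      linarith
    rw [Real.cos_two_mul, Real.cos_sq', Real.sin_arcsin (by linarith [Real.sqrt_nonneg Y]) h1,
      Real.sq_sqrt hY]
    ring
  have hcosD : Real.cos (Real.arccos (2 * S - 1 + 2 * Y)) = 2 * S - 1 + 2 * Y :=
    Real.cos_arccos (by linarith) (by linarith)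
  refine ⟨_, Real.arccos (2 * S - 1 + 2 * Y), rfl, ?_, ?_⟩
  · rw [hcosη, hcosD, walkEigenvalue, hSd, hYd]
    push_cast
    field_simp
    ring
  · rw [hcosη, hcosD, walkEigenvalue, hSd, hYd]
    push_cast
    field_simp
    ring

/-- Phases for which the blocks of the walk rotate by multiples of `2 π` after `t` steps, while the
relative phase of the constants is close to `π`. -/
lemma exists_arePhases_of_approx {N r a b t V : ℕ} {v : ℝ} (hN : 5 ≤ N) (hr : 2 ≤ r) (hrN : r < N)
    (ha : Even a) (hb : Even b) (ha0 : 0 < a) (hab : a < b) (hV : Odd V) (hv : 1 ≤ v)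
    (hv2 : v ^ 2 = a ^ 2 - (b ^ 2 - a ^ 2) * (N / (N - 2))) (hvV : |v - V| ≤ 1 / 20)
    (ht : t = 100 * b ^ 2 * (Nat.sqrt r + 1)) :
    ∃ θ₁ θ₂ β : ℝ, ∃ c : ℂ, Real.cos β ^ 2 ≤ 1 / 100 ∧ ArePhases N r t θ₁ θ₂ β c := by
  have hpi := Real.pi_pos
  have hb0 : (0 : ℝ) < b := by exact_mod_cast ha0.trans hab
  have hab' : (a : ℝ) + 1 ≤ b := by exact_mod_cast hab
  have ha0' : (1 : ℝ) ≤ a := by exact_mod_cast ha0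
  have hN' : (5 : ℝ) ≤ N := by exact_mod_cast hN
  have hr' : (2 : ℝ) ≤ r := by exact_mod_cast hr
  have hrN' : (r : ℝ) < N := by exact_mod_cast hrN
  set s : ℝ := (Nat.sqrt r : ℝ) + 1 with hs
  have hs1 : 1 ≤ s := by
    rw [hs]
    linarith [(Nat.cast_nonneg (Nat.sqrt r) : (0 : ℝ) ≤ _)]
  have hs2 : (r : ℝ) + 1 ≤ s ^ 2 := by
    have := Nat.lt_succ_sqrt r
    have h2 : r + 1 ≤ (Nat.sqrt r + 1) * (Nat.sqrt r + 1) := this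
    rw [hs, pow_two]
    exact_mod_cast h2
  have htr : (t : ℝ) = 100 * b ^ 2 * s := by
    rw [ht, hs]
    push_cast
    ring
  have ht0 : (0 : ℝ) < t := by rw [htr]; positivity
  -- The angles will be δ₁ = 2ah and δ₂ = 2bh, so tδ₁ = aπ and tδ₂ = bπ are multiples of 2π for even
  -- a and b. To leading order Y = v²h², which makes tη/2 close to vπ/2.
  set h : ℝ := Real.pi / (2 * t) with hh
  have hh0 : 0 < h := by positivity
  have hbsh : b ^ 2 * s * h ≤ 1 / 50 := by
    have : b ^ 2 * s * h = Real.pi / 200 := by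
      rw [hh, htr]
      field_simp
      norm_num
    rw [this]
    linarith [Real.pi_lt_four]
  have hb2h : (b : ℝ) ^ 2 * h ≤ 1 / 50 := by
    refine le_trans ?_ hbsh
    gcongr
    exact le_mul_of_one_le_right (by positivity) hs1
  have hbh : b * h ≤ 1 / 50 := by
    refine le_trans ?_ hb2h
    gcongr
    exact le_self_pow₀ (by linarith) (by norm_num)
  have hB4 : (b : ℝ) ^ 4 * h ^ 2 ≤ 1 / 200 := by
    have : (b : ℝ) ^ 4 * h ^ 2 = (b ^ 2 * h) ^ 2 := by ring
    rw [this]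
    have h0 : ((b : ℝ) ^ 2 * h) ^ 2 ≤ (1 / 50) ^ 2 := pow_le_pow_left₀ (by positivity) hb2h 2
    linarith
  have hah : a * h ≤ b * h := by gcongr
  have hah0 : 0 < a * h := by positivity
  set A₁ := Real.sin (a * h) ^ 2 with hA₁
  set A₂ := Real.sin (b * h) ^ 2 with hA₂
  have hA₁u : A₁ ≤ (a * h) ^ 2 := sin_sq_le_sq
  have hA₂u : A₂ ≤ (b * h) ^ 2 := sin_sq_le_sq
  have hA₁l := sq_sub_le_sin_sq hah0.le (by linarith)
  have hA₂l := sq_sub_le_sin_sq (hah0.le.trans hah) (by linarith)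
  rw [← hA₁] at hA₁l
  rw [← hA₂] at hA₂l
  have hA : A₁ ≤ A₂ := by
    apply pow_le_pow_left₀
    · exact Real.sin_nonneg_of_nonneg_of_le_pi hah0.le (by linarith [Real.pi_gt_three])
    · exact Real.sin_le_sin_of_le_of_le_pi_div_two (by linarith) (by linarith [Real.pi_gt_three])
        hah
  have hA₁0 : 0 ≤ A₁ := sq_nonneg _
  set κ : ℝ := N / (N - 2) with hκ
  have hN2 : (0 : ℝ) < N - 2 := by linarith
  have hNr : (0 : ℝ) < N - r := by linarith
  have hκ1 : κ ≤ 5 / 3 := by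
    rw [hκ, div_le_iff₀ hN2]
    linarith
  have hκ0 : 0 ≤ κ := by rw [hκ]; positivity
  set Y := A₁ - (A₂ - A₁) * κ with hY
  set S := (A₂ - A₁) * ((r + 1) * (N - r) / (N - 2)) with hS
  have hYv : |Y - v ^ 2 * h ^ 2| ≤ 2 * b ^ 4 * h ^ 4 := by
    have h1 := abs_sin_sq_combination_le hκ0 hκ1 hah0.le hah (by linarith : b * h ≤ 1)
    rw [← hA₁, ← hA₂, ← hY] at h1
    have e₁ : v ^ 2 * h ^ 2 = (a * h) ^ 2 - ((b * h) ^ 2 - (a * h) ^ 2) * κ := by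
      rw [hv2]
      ring
    have e₂ : 2 * b ^ 4 * h ^ 4 = 2 * (b * h) ^ 4 := by ring
    rw [e₁, e₂]
    exact h1
  have hY0 : 0 ≤ Y := by
    have h1 := (abs_le.1 hYv).1
    have h2 : (b : ℝ) ^ 4 * h ^ 2 * h ^ 2 ≤ 1 / 200 * h ^ 2 := by gcongr
    have h3 : 1 * h ^ 2 ≤ v ^ 2 * h ^ 2 := by
      gcongr
      exact one_le_pow₀ hv
    linarith [sq_nonneg h]
  have hY1 : Y ≤ 1 / 4 := by
    have h1 : 0 ≤ (A₂ - A₁) * κ := mul_nonneg (by linarith) hκ0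
    have h2 : (a * h) ^ 2 ≤ (1 / 50) ^ 2 := pow_le_pow_left₀ hah0.le (hah.trans hbh) 2
    linarith
  have hS0 : 0 ≤ S := mul_nonneg (by linarith) (by positivity)
  -- The differences of the eigenvalues are of order 1/r; the factor √r in t compensates for this.
  have hS1 : S ≤ 1 / 4 := by
    have h1 : ((r : ℝ) + 1) * (N - r) / (N - 2) ≤ s ^ 2 := by
      rw [div_le_iff₀ hN2]
      gcongr
    calc S ≤ (b * h) ^ 2 * s ^ 2 := by
          rw [hS]
          gcongr
          linarith
      _ ≤ (b ^ 2 * s * h) ^ 2 := by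
          have : (b ^ 2 * s * h) ^ 2 = (b * h) ^ 2 * s ^ 2 * b ^ 2 := by ring
          rw [this]
          apply le_mul_of_one_le_right (by positivity)
          exact one_le_pow₀ (by linarith)
      _ ≤ 1 / 4 := by
          have h2 : (b ^ 2 * s * h) ^ 2 ≤ (1 / 50) ^ 2 := pow_le_pow_left₀ (by positivity) hbsh 2
          linarith
  obtain ⟨η, D, hη, hD₁, hD₂⟩ := exists_angles hr hrN hY0 hS0 (by linarith : S + Y ≤ 1)
  obtain ⟨a', ha'⟩ := ha
  obtain ⟨b', hb'⟩ := hb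
  have hth : t * (2 * h) = Real.pi := by
    rw [hh]
    field_simp
  have hvb : v ≤ a := by
    refine le_of_sq_le_sq ?_ (by linarith)
    rw [hv2]
    have h1 : (a : ℝ) ^ 2 ≤ b ^ 2 := pow_le_pow_left₀ (by linarith) (by linarith) 2
    linarith [mul_nonneg (by linarith : (0 : ℝ) ≤ b ^ 2 - a ^ 2) hκ0]
  have hsin : ∀ z : ℝ, 0 < z → z ≤ 1 / 50 → Real.sin (2 * z) ≠ 0 := fun z h0 h1 =>
    (Real.sin_pos_of_pos_of_lt_pi (by linarith) (by linarith [Real.pi_gt_three])).ne'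
  have hcos : ∀ z : ℝ, Real.cos (2 * z) = 1 - 2 * Real.sin z ^ 2 := fun z => by
    rw [Real.cos_two_mul, Real.cos_sq']
    ring
  have key := arePhases_of_angles (N := N) (r := r) (t := t) (η := η) (D := D)
    (δ := fun k => if k = 1 then 2 * (a * h) else 2 * (b * h)) ?_
  · refine ⟨_, _, _, _, ?_, key⟩
    have hβ := cos_mul_arcsin_sqrt_sq_le (Y := Y) (B := b) (by exact_mod_cast ht0) hh hV hv hvV
      (by linarith) hB4 (by linarith) hYv
    rwa [hη, show t * (2 * Real.arcsin (Real.sqrt Y)) / 2 = t * Real.arcsin (Real.sqrt Y) by ring]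
  · intro k hk
    rcases hk with rfl | rfl
    · simp only [if_true]
      refine ⟨hsin _ hah0 (hah.trans hbh), ?_, a', ?_⟩
      · rw [hD₁, hcos, ← hA₁]
      · rw [ha']
        push_cast
        linear_combination (2 * a' : ℝ) * hth
    · simp only [show (2 : ℕ) ≠ 1 by norm_num, if_false]
      refine ⟨hsin _ (by linarith) hbh, ?_, b', ?_⟩
      · rw [hD₂, hcos, ← hA₂]
      · rw [hb']
        push_cast
        linear_combination (2 * b' : ℝ) * hth

/-- There are suitable phases with `O(√r)` steps. -/
lemma exists_arePhases : ∃ C : ℕ, ∀ N r : ℕ, 5 ≤ N → 2 ≤ r → r < N →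
    ∃ (t : ℕ) (θ₁ θ₂ β : ℝ) (c : ℂ), t ≤ C * (Nat.sqrt r + 1) ∧ Real.cos β ^ 2 ≤ 1 / 100 ∧
      ArePhases N r t θ₁ θ₂ β c := by
  -- 10⁹ bounds b in all cases; the largest values occur for N just below 1000.
  refine ⟨100 * (10 ^ 9) ^ 2, fun N r hN hr hrN => ?_⟩
  rcases le_or_gt 1000 N with hN' | hN'
  · have hNr : (1000 : ℝ) ≤ N := by exact_mod_cast hN'
    have hN2 : (0 : ℝ) < N - 2 := by linarith
    have hκ1 : (N : ℝ) / (N - 2) ≤ 1.0021 := by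
      rw [div_le_iff₀ hN2]
      linarith
    have hκ0 : 1 ≤ (N : ℝ) / (N - 2) := by
      rw [le_div_iff₀ hN2]
      linarith
    have hv2 : Real.sqrt (400 - 176 * (N / (N - 2))) ^ 2 = 400 - 176 * ((N : ℝ) / (N - 2)) :=
      Real.sq_sqrt (by linarith)
    have hvl : 14.95 ≤ Real.sqrt (400 - 176 * (N / (N - 2))) :=
      Real.le_sqrt_of_sq_le (by norm_num at hκ1 ⊢; linarith)
    have hvu : Real.sqrt (400 - 176 * (N / (N - 2))) ≤ 15.05 := by
      rw [Real.sqrt_le_left (by norm_num)]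
      norm_num
      linarith
    -- As κ tends to 1, v² tends to 2 · 20² - 24² = 224, which is close to 15².
    obtain ⟨θ₁, θ₂, β, c, hβ, h⟩ := exists_arePhases_of_approx (a := 20) (b := 24) (V := 15)
      (t := 100 * 24 ^ 2 * (Nat.sqrt r + 1))
      (v := Real.sqrt (400 - 176 * (N / (N - 2)))) hN hr hrN (by decide) (by decide) (by norm_num)
      (by norm_num) (by decide) (by linarith) (by rw [hv2]; push_cast; ring)
      (by rw [abs_le]; push_cast; constructor <;> linarith) rfl
    refine ⟨_, θ₁, θ₂, β, c, ?_, hβ, h⟩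
    apply Nat.mul_le_mul_right
    norm_num
  · have hN5 : (5 : ℝ) ≤ N := by exact_mod_cast hN
    have hN2 : (0 : ℝ) < N - 2 := by linarith
    obtain ⟨n, rfl⟩ : ∃ n, N = n + 2 := ⟨N - 2, by omega⟩
    have hle : 20 * (n + 2) + 1 ≤ 400 * ((n + 2) * (n + 1)) := by
      have h1 : (n + 2) * 1 ≤ (n + 2) * (n + 1) := Nat.mul_le_mul_left _ (by omega)
      omega
    -- Here κ = (n+2)/n is not close enough to 1. The difference b - a = 20n clears the denominator,
    -- and a = 400(n+2)(n+1) is chosen to cancel the quadratic terms of V² - v², which leaves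
    -- 40(n+2) + 1. This is small against V, so v is within 1/20 of the odd number V.
    set V : ℕ := 400 * ((n + 2) * (n + 1)) - 20 * (n + 2) - 1 with hV
    have hVr : (V : ℝ) = 400 * ((n + 2) * (n + 1)) - 20 * (n + 2) - 1 := by
      have h1 : V + 20 * (n + 2) + 1 = 400 * ((n + 2) * (n + 1)) := by
        omega
      have h2 : ((V + 20 * (n + 2) + 1 : ℕ) : ℝ) = (400 * ((n + 2) * (n + 1)) : ℕ) := by rw [h1]
      push_cast at h2
      linarith
    have hn3 : (3 : ℝ) ≤ n := by
      push_cast at hN5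
      linarith
    have hVbig : 40 * (40 * ((n : ℝ) + 2) + 1) / 2 ≤ V := by
      rw [hVr]
      nlinarith
    set v : ℝ := Real.sqrt (V ^ 2 - 40 * (n + 2) - 1) with hv
    have hv2 : v ^ 2 = V ^ 2 - 40 * (n + 2) - 1 := Real.sq_sqrt (by
      have h1 : (V : ℝ) * 1 ≤ V * V := by gcongr; linarith
      linarith)
    have hvl : V - 1 / 20 ≤ v := Real.le_sqrt_of_sq_le (by
      have h1 : ((V : ℝ) - 1 / 20) ^ 2 = V ^ 2 - V / 10 + 1 / 400 := by ring
      linarith)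
    have hvu : v ≤ V := by
      rw [hv, Real.sqrt_le_left (by positivity)]
      linarith
    obtain ⟨θ₁, θ₂, β, c, hβ, h⟩ := exists_arePhases_of_approx
      (t := 100 * (400 * ((n + 2) * (n + 1)) + 20 * n) ^ 2 * (Nat.sqrt r + 1))
      (a := 400 * ((n + 2) * (n + 1))) (b := 400 * ((n + 2) * (n + 1)) + 20 * n) (V := V)
      (v := v) hN hr hrN (Even.mul_right (by decide) _)
      ((Even.mul_right (by decide) _).add (Even.mul_right (by decide) _))
      (by positivity) (by omega)
      (by
        rw [hV, Nat.odd_iff]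
        omega)
      (by linarith) (by
        rw [hv2, hVr]
        have : (n : ℝ) ≠ 0 := by linarith
        push_cast
        rw [add_sub_cancel_right]
        field_simp
        ring)
      (by rw [abs_le]; constructor <;> linarith) rfl
    refine ⟨_, θ₁, θ₂, β, c, ?_, hβ, h⟩
    apply Nat.mul_le_mul_right
    apply Nat.mul_le_mul_left
    apply Nat.pow_le_pow_left
    have hn : n ≤ 1000 := by omega
    nlinarith

/-! ### The exact walk -/

/-- For r ≥ 5 the fraction is at most r²/N² ≤ 1/r ≤ 1/5. Among the small cases the bound is attained
at r = 4, N = 8. -/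
lemma markedFraction_le {N r : ℕ} (hN : 5 ≤ N) (hr : 2 ≤ r) (hrN : r < N) (h : r ^ 3 ≤ N ^ 2) :
    markedFraction N r ≤ 3 / 14 := by
  have hN' : (5 : ℝ) ≤ N := by exact_mod_cast hN
  have hr' : (2 : ℝ) ≤ r := by exact_mod_cast hr
  have hrN' : (r : ℝ) + 1 ≤ N := by exact_mod_cast hrN
  have h' : (r : ℝ) ^ 3 ≤ N ^ 2 := by exact_mod_cast h
  have hNN : (0 : ℝ) < N * (N - 1) := by nlinarith
  rw [markedFraction, div_le_iff₀ hNN]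
  rcases le_or_gt 5 r with h5 | h5
  · have h5' : (5 : ℝ) ≤ r := by exact_mod_cast h5
    have h1 : 5 * (r : ℝ) ^ 2 ≤ N ^ 2 := by nlinarith
    nlinarith
  · interval_cases r
    · push_cast
      nlinarith
    · have h6 : 6 ≤ N := by nlinarith
      have h6' : (6 : ℝ) ≤ N := by exact_mod_cast h6
      push_cast
      nlinarith
    · have h8 : 8 ≤ N := by nlinarith
      have h8' : (8 : ℝ) ≤ N := by exact_mod_cast h8
      push_cast
      nlinarith

lemma sq_div_le_markedFraction {N r : ℕ} (hr : 2 ≤ r) (hrN : r < N) :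
    (r / N : ℝ) ^ 2 / 2 ≤ markedFraction N r := by
  have hr' : (2 : ℝ) ≤ r := by exact_mod_cast hr
  have hrN' : (r : ℝ) + 1 ≤ N := by exact_mod_cast hrN
  have hN0 : (0 : ℝ) < N := by linarith
  have hN1 : (0 : ℝ) < N - 1 := by linarith
  have h1 : (r / N : ℝ) ^ 2 / 2 = r * (r / 2) / (N * N) := by
    field_simp
  have h2 : (0 : ℝ) ≤ r * (r - 1) := mul_nonneg (by linarith) (by linarith)
  rw [h1, markedFraction]
  gcongr
  · linarith
  · linarith

/-- The number of rounds: a multiple of `4 arcsin √x` in `[π / 2, π]`. -/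
lemma exists_outer {x y : ℝ} (hx : x ≤ 3 / 14) (hy0 : 0 < y) (hy1 : y ≤ 1) (hyx : (y / 2) ^ 2 ≤ x) :
    ∃ n : ℕ, Real.pi / 2 ≤ n * (4 * Real.arcsin (Real.sqrt x)) ∧
      n * (4 * Real.arcsin (Real.sqrt x)) ≤ Real.pi ∧ (n : ℝ) ≤ 2 / y := by
  have hx0 : 0 < x := lt_of_lt_of_le (by positivity) hyx
  obtain ⟨hg0, hgpi, -, -⟩ := four_arcsin_sqrt hx0 hx
  have hgy : 2 * y ≤ 4 * Real.arcsin (Real.sqrt x) := by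
    have h1 : y / 2 ≤ Real.sqrt x := Real.le_sqrt_of_sq_le hyx
    have h2 : Real.sqrt x ≤ Real.arcsin (Real.sqrt x) := by
      have h4 : Real.sqrt x ≤ 1 := by
        rw [Real.sqrt_le_left zero_le_one]
        linarith
      have h3 := Real.sin_le (Real.arcsin_nonneg.2 (Real.sqrt_nonneg x))
      rwa [Real.sin_arcsin (by linarith [Real.sqrt_nonneg x]) h4] at h3
    linarith
  generalize 4 * Real.arcsin (Real.sqrt x) = g at *
  have hpi := Real.pi_pos
  -- The first multiple of g beyond π/2 does not exceed π: it is at most π/2 + g if g ≤ π/2, and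
  -- otherwise it is g < π itself.
  refine ⟨⌈Real.pi / 2 / g⌉₊, ?_, ?_, ?_⟩
  · rw [← div_le_iff₀ hg0]
    exact Nat.le_ceil _
  · rcases le_or_gt g (Real.pi / 2) with h | h
    · have h1 := (Nat.ceil_lt_add_one (by positivity : 0 ≤ Real.pi / 2 / g)).le
      calc (⌈Real.pi / 2 / g⌉₊ : ℝ) * g ≤ (Real.pi / 2 / g + 1) * g := by gcongr
        _ = Real.pi / 2 + g := by field_simp
        _ ≤ Real.pi := by linarith
    · have h1 : ⌈Real.pi / 2 / g⌉₊ ≤ 1 := by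
        rw [Nat.ceil_le, Nat.cast_one, div_le_one hg0]
        exact h.le
      have h2 : (⌈Real.pi / 2 / g⌉₊ : ℝ) ≤ 1 := by exact_mod_cast h1
      nlinarith
  · have h1 := (Nat.ceil_lt_add_one (by positivity : 0 ≤ Real.pi / 2 / g)).le
    have h2 : Real.pi / 2 / g ≤ Real.pi / 2 / (2 * y) := by gcongr
    have h3 : Real.pi / 2 / (2 * y) ≤ 1 / y := by
      rw [div_le_div_iff₀ (by positivity) hy0]
      nlinarith [Real.pi_lt_four]
    have h4 : 1 ≤ 1 / y := by
      rw [le_div_iff₀ hy0]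
      linarith
    have h5 : 2 / y = 1 / y + 1 / y := by ring
    linarith

/-- The walk with suitable parameters ends in marked states whenever there is one colliding pair. -/
lemma exists_exact_walk : ∃ C : ℕ, ∀ N r : ℕ, 5 ≤ N → 2 ≤ r → r < N → r ^ 3 ≤ N ^ 2 →
    ∃ P : WalkParams, P.inner ≤ C * (Nat.sqrt r + 1) ∧ (P.outer : ℝ) ≤ 2 * N / r ∧
      ∀ (M m : ℕ) (x : Fin N → Fin M), M ≤ 2 ^ m → AtMostOneCollidingPair x →
        ∀ z : WalkBasis N r m, P.final r m x z ≠ 0 → IsCorrect x (walkOut z) := by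
  obtain ⟨C, hC⟩ := exists_arePhases
  refine ⟨C, fun N r hN hr hrN h3 => ?_⟩
  obtain ⟨t, θ₁, θ₂, b, c, ht, hb, hone, l, l', hl⟩ := hC N r hN hr hrN
  have hp1 := markedFraction_le hN hr hrN h3
  have hp2 := sq_div_le_markedFraction hr hrN
  have hr' : (2 : ℝ) ≤ r := by exact_mod_cast hr
  have hrN' : (r : ℝ) + 1 ≤ N := by exact_mod_cast hrN
  have hy0 : (0 : ℝ) < r / N := div_pos (by linarith) (by linarith)
  have hy1 : (r / N : ℝ) ≤ 1 := by
    rw [div_le_one (by linarith)]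
    linarith
  have hp0 : 0 < markedFraction N r := lt_of_lt_of_le (by positivity) hp2
  have hbb := Real.sin_sq_add_cos_sq b
  -- Since sin² b ≥ 99/100 and p ≥ (r/N)²/2, the product is at least (r/(2N))².
  obtain ⟨n, hn, hn', hn2⟩ := exists_outer
    (x := markedFraction N r * Real.sin b ^ 2) (y := r / N) (by nlinarith [sq_nonneg (Real.cos b)])
    hy0 hy1 (by nlinarith [sq_nonneg (r / N : ℝ)])
  obtain ⟨a₁, a₂, him, hcheb⟩ := exists_marking_phases hp0 hp1 hb n hn hn'
  let P : WalkParams := ⟨θ₁, θ₂, 2 * a₁, 2 * a₂, n, t⟩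
  refine ⟨P, ht, ?_, ?_⟩
  · refine hn2.trans (le_of_eq ?_)
    rw [div_div_eq_mul_div]
  · intro M m x hM hx z hz
    rw [final_eq_withSlots hrN hM, withSlots] at hz
    split_ifs at hz with hs
    · have hzz : z = (z.1, setSlots m x z.1) := Prod.ext rfl hs
      rw [hzz]
      apply isCorrect_walkOut hM
      -- On an injective string no basis state in the support is marked, so every outcome reads "all
      -- distinct".
      rcases hx with hx | ⟨i, j, hij, hxij, huniq⟩
      · exact Or.inr hx
      · left
        by_contra hcol
        apply hz
        have hiff : ∀ v : Vertex N r, HasCollision x v ↔ i ∈ v.1.1 ∧ j ∈ v.1.1 := by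
          intro v
          constructor
          · rintro ⟨a, ha, b, hb, hab, h⟩
            rcases huniq a b hab h with ⟨rfl, rfl⟩ | ⟨rfl, rfl⟩
            · exact ⟨ha, hb⟩
            · exact ⟨hb, ha⟩
          · rintro ⟨hi, hj⟩
            exact ⟨i, hi, j, hj, hij, hxij⟩
        refine vertexRound_iterate_eq_zero P x hiff (p := markedFraction N r) (b := b) (c := c)
          rfl rfl ?_ ?_ him hcheb _ z.1 hcol
        · rw [vertexStep_pow_one hrN, ← hone]
        · rw [← hone]
          exact vertexStep_pow_pairIndicator hrN (by omega) hij hl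
    · exact absurd rfl hz

/-- The query count of the walk. -/
lemma queries_le {N r C : ℕ} {y : ℝ} (hy : 1 ≤ y) (hyN : (N : ℝ) = y ^ 3) (hr2 : 2 ≤ r)
    (hr : (r : ℝ) ≤ y ^ 2) (hr' : y ^ 2 < r + 1) (P : WalkParams)
    (hi : P.inner ≤ C * (Nat.sqrt r + 1)) (ho : (P.outer : ℝ) ≤ 2 * N / r) :
    (P.queries r : ℝ) ≤ (4 + 32 * C) * y ^ 2 := by
  have hr2' : (2 : ℝ) ≤ r := by exact_mod_cast hr2
  set s := Real.sqrt r with hs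
  have hss : s ^ 2 = r := Real.sq_sqrt (by linarith)
  have hs1 : 1 ≤ s := Real.le_sqrt_of_sq_le (by linarith)
  have hsy : y / 2 ≤ s := Real.le_sqrt_of_sq_le (by nlinarith)
  have hi' : (P.inner : ℝ) ≤ C * (2 * s) := by
    have h1 : (P.inner : ℝ) ≤ C * (Nat.sqrt r + 1) := by exact_mod_cast hi
    have h2 : (Nat.sqrt r : ℝ) ≤ s := Real.nat_sqrt_le_real_sqrt
    refine h1.trans ?_
    gcongr
    linarith
  -- N/√r is of order y³/y = y².
  have ho' : (P.outer : ℝ) * s ≤ 4 * y ^ 2 := by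
    calc (P.outer : ℝ) * s ≤ 2 * N / r * s := by gcongr
      _ = 2 * y ^ 3 / s := by
        rw [← hss, hyN]
        field_simp
      _ ≤ 2 * y ^ 3 / (y / 2) := by gcongr
      _ = 4 * y ^ 2 := by
        field_simp
        ring
  have h3 : (P.outer : ℝ) * P.inner ≤ C * (8 * y ^ 2) := by
    calc (P.outer : ℝ) * P.inner ≤ P.outer * (C * (2 * s)) := by gcongr
      _ = 2 * C * (P.outer * s) := by ring
      _ ≤ 2 * C * (4 * y ^ 2) := by gcongr
      _ = C * (8 * y ^ 2) := by ring
  rw [WalkParams.queries]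
  push_cast
  nlinarith

end ElementDistinctness

end

/-! ### The theorem: r = ⌊N^{2/3}⌋ for N ≥ 5, direct querying for N ≤ 4 -/

theorem theorem1 :
    ∃ C : ℝ, 0 < C ∧ ∀ N M m : ℕ, 1 ≤ N → N ≤ M → M ≤ 2 ^ m →
      ∃ A : ElementDistinctness.QueryAlgorithm N m,
        A.SolvesExactly M ∧
        (A.queries : ℝ) ≤ C * (N : ℝ) ^ (2 / 3 : ℝ) ∧
        (5 ≤ N → ∃ P : ElementDistinctness.WalkParams,
          A.Implements M ⌊(N : ℝ) ^ (2 / 3 : ℝ)⌋₊ P) := by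
  obtain ⟨C, hC⟩ := ElementDistinctness.exists_exact_walk
  refine ⟨4 + 32 * C, by positivity, fun N M m hN hNM hM => ?_⟩
  have hN' : (1 : ℝ) ≤ N := by exact_mod_cast hN
  obtain ⟨y, hy⟩ : ∃ y : ℝ, y = (N : ℝ) ^ (1 / 3 : ℝ) := ⟨_, rfl⟩
  have hy1 : 1 ≤ y := by
    rw [hy]
    exact Real.one_le_rpow hN' (by norm_num)
  have hyN : (N : ℝ) = y ^ 3 := by
    rw [hy, ← Real.rpow_natCast, ← Real.rpow_mul (by linarith)]
    norm_num
  have hy2 : (N : ℝ) ^ (2 / 3 : ℝ) = y ^ 2 := by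
    rw [hy, ← Real.rpow_natCast, ← Real.rpow_mul (by linarith)]
    norm_num
  rw [hy2]
  rcases le_or_gt 5 N with h5 | h5
  · have h5' : (5 : ℝ) ≤ y ^ 3 := by
      rw [← hyN]
      exact_mod_cast h5
    set r := ⌊y ^ 2⌋₊ with hr
    have hr1 : (r : ℝ) ≤ y ^ 2 := Nat.floor_le (by positivity)
    have hr2 : y ^ 2 < r + 1 := Nat.lt_floor_add_one _
    -- (3/2)³ < 5, and y ≥ 3/2 gives y² ≥ 9/4, hence r ≥ 2: a set S can hold a pair.
    have hyl : 3 / 2 ≤ y := by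
      by_contra! h
      have : y ^ 3 < (3 / 2) ^ 3 := pow_lt_pow_left₀ h (by linarith) (by norm_num)
      norm_num at this
      linarith
    have hr3 : 2 ≤ r := by
      rw [hr, Nat.le_floor_iff (by positivity)]
      push_cast
      nlinarith
    have hrN : r < N := by
      have h1 : (r : ℝ) < N := by
        rw [hyN]
        refine hr1.trans_lt ?_
        nlinarith
      exact_mod_cast h1
    have hr6 : r ^ 3 ≤ N ^ 2 := by
      have h1 : (r : ℝ) ^ 3 ≤ N ^ 2 := by
        rw [hyN]
        calc (r : ℝ) ^ 3 ≤ (y ^ 2) ^ 3 := by gcongr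
          _ = (y ^ 3) ^ 2 := by ring
      exact_mod_cast h1
    obtain ⟨P, hi, ho, hP⟩ := hC N r h5 hr3 hrN hr6
    obtain ⟨A, hA, hA', hA2⟩ := ElementDistinctness.exists_implements (m := m) hrN hM P
    refine ⟨A, fun x hx => hA2 x (hP M m x hM hx), ?_, fun _ => ⟨P, hA'⟩⟩
    rw [hA]
    exact ElementDistinctness.queries_le hy1 hyN hr3 hr1 hr2 P hi ho
  · obtain ⟨A, hA, hq⟩ := ElementDistinctness.exists_solvesExactly_with_queries_eq hN hM
    refine ⟨A, hA, ?_, fun h => absurd h (by omega)⟩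
    rw [hq]
    have h4 : (N : ℝ) ≤ 4 := by exact_mod_cast (by omega : N ≤ 4)
    have h1 : 1 ≤ y ^ 2 := one_le_pow₀ hy1
    have h2 : (0 : ℝ) ≤ C := Nat.cast_nonneg C
    nlinarith [mul_nonneg h2 (by linarith : (0 : ℝ) ≤ y ^ 2)]
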